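/- For a finite simple graph $G=(V,E)$ and a proper coloring $\varphi:V\to\mathbb{N}^{+}$, the entropy of $\varphi$ is $H(\varphi)=-\sum_i p_i\log_2 p_i$, where $p_i=|\varphi^{-1}(i)|/|V|$ and $0\log_2 0=0$. The minimum entropy coloring problem asks, given $G$, for a proper coloring of minimum entropy. On (unweighted) interval graphs, that is, intersection graphs of finite families of intervals of the real line, the minimum entropy coloring problem can be approximated within an additive error of 1 bit in polynomial time. That is, there is an algorithm which, given (the adjacency matrix of) any interval graph $G$ on $n$ vertices, outputs, in time polynomial in $n$, a proper coloring $\varphi$ of $G$ such that $H(\varphi)\le H(\psi)+1$ for every proper coloring $\psi$ of $G$. -/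

import Mathlib

/-! ### Interval graphs and the entropy of a coloring -/

/-- An interval graph: the intersection graph of a family of nonempty closed real intervals
`[l v, r v]`. -/
def IsIntervalGraph {V : Type*} (G : SimpleGraph V) : Prop :=
  ∃ l r : V → ℝ, (∀ v, l v ≤ r v) ∧
    ∀ v w, G.Adj v w ↔ v ≠ w ∧ (Set.Icc (l v) (r v) ∩ Set.Icc (l w) (r w)).Nonempty

/-- The fraction `|φ⁻¹(i)| / |V|` of the vertices that receive the color `i`. -/
noncomputable def colorFraction {V : Type*} [Fintype V] {G : SimpleGraph V}
    (φ : G.Coloring ℕ+) (i : ℕ+) : ℝ :=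
  ((Finset.univ.filter fun v => φ v = i).card : ℝ) / (Fintype.card V : ℝ)

/-- The entropy (in bits) of the color of a uniformly random vertex. Colors that are not used
contribute `0 log 0 = 0`, so that the sum runs over the colors that are used. -/
noncomputable def coloringEntropy {V : Type*} [Fintype V] {G : SimpleGraph V}
    (φ : G.Coloring ℕ+) : ℝ :=
  -∑ i ∈ Finset.univ.image φ, colorFraction φ i * Real.logb 2 (colorFraction φ i)

/-! ### A random access machine with a step count

The machine has registers and arrays of natural numbers, indirect addressing, addition and
truncated subtraction (no multiplication), each at unit cost. A number grows by at most one bit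
per step, so polynomial time on this machine is polynomial time on a Turing machine. -/

namespace RAM

/-- Programs. `a b c` are register names and `A` is an array name; a program is a finite
object, so it names only finitely many registers and arrays. -/
inductive Prog : Type
  /-- do nothing -/
  | skip : Prog
  /-- `a := k` for a constant `k` -/
  | const (a k : ℕ) : Prog
  /-- `a := b` -/
  | copy (a b : ℕ) : Prog
  /-- `a := b + c` -/
  | add (a b c : ℕ) : Prog
  /-- `a := b - c`, truncated at zero -/
  | sub (a b c : ℕ) : Prog
  /-- `a := A[b]` -/
  | load (a A b : ℕ) : Prog
  /-- `A[a] := b` -/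
  | store (A a b : ℕ) : Prog
  /-- first `p`, then `q` -/
  | seq (p q : Prog) : Prog
  /-- if `a ≠ 0` then `p` else `q` -/
  | cond (a : ℕ) (p q : Prog) : Prog
  /-- while `a ≠ 0` do `p` -/
  | loop (a : ℕ) (p : Prog) : Prog

/-- A state of the machine: the contents of the registers and of the arrays. -/
structure State : Type where
  /-- `reg a` is the content of the register `a` -/
  reg : ℕ → ℕ
  /-- `arr A i` is the entry of the array `A` at the index `i` -/
  arr : ℕ → ℕ → ℕ

/-- Write the value `x` into the register `a`. -/
def State.setReg (s : State) (a x : ℕ) : State :=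
  { s with reg := Function.update s.reg a x }

/-- Write the value `x` into the array `A` at the index `i`. -/
def State.setArr (s : State) (A i x : ℕ) : State :=
  { s with arr := Function.update s.arr A (Function.update (s.arr A) i x) }

/-- `Exec p s t s'`: started in the state `s`, the program `p` halts in the state `s'` after
exactly `t` steps. Every elementary instruction and every test of a register is one step. -/
inductive Exec : Prog → State → ℕ → State → Prop
  | skip (s : State) : Exec .skip s 1 s
  | const (s : State) (a k : ℕ) : Exec (.const a k) s 1 (s.setReg a k)
  | copy (s : State) (a b : ℕ) : Exec (.copy a b) s 1 (s.setReg a (s.reg b))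
  | add (s : State) (a b c : ℕ) : Exec (.add a b c) s 1 (s.setReg a (s.reg b + s.reg c))
  | sub (s : State) (a b c : ℕ) : Exec (.sub a b c) s 1 (s.setReg a (s.reg b - s.reg c))
  | load (s : State) (a A b : ℕ) : Exec (.load a A b) s 1 (s.setReg a (s.arr A (s.reg b)))
  | store (s : State) (A a b : ℕ) : Exec (.store A a b) s 1 (s.setArr A (s.reg a) (s.reg b))
  | seq {p q : Prog} {s s₁ s₂ : State} {t₁ t₂ : ℕ} :
      Exec p s t₁ s₁ → Exec q s₁ t₂ s₂ → Exec (.seq p q) s (t₁ + t₂) s₂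
  | cond_true {a : ℕ} {p q : Prog} {s s₁ : State} {t : ℕ} :
      s.reg a ≠ 0 → Exec p s t s₁ → Exec (.cond a p q) s (t + 1) s₁
  | cond_false {a : ℕ} {p q : Prog} {s s₁ : State} {t : ℕ} :
      s.reg a = 0 → Exec q s t s₁ → Exec (.cond a p q) s (t + 1) s₁
  | loop_done {a : ℕ} {p : Prog} {s : State} :
      s.reg a = 0 → Exec (.loop a p) s 1 s
  | loop_step {a : ℕ} {p : Prog} {s s₁ s₂ : State} {t₁ t₂ : ℕ} :
      s.reg a ≠ 0 → Exec p s t₁ s₁ → Exec (.loop a p) s₁ t₂ s₂ →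
        Exec (.loop a p) s (t₁ + t₂ + 1) s₂

open Classical in
/-- The input state for a graph on `n` vertices: register `0` holds `n`, array `0` holds the
adjacency matrix row by row, and everything else is `0`. -/
noncomputable def graphInput {n : ℕ} (G : SimpleGraph (Fin n)) : State where
  reg := fun a => if a = 0 then n else 0
  arr := fun A k =>
    if A = 0 ∧ ∃ i j : Fin n, k = (i : ℕ) * n + (j : ℕ) ∧ G.Adj i j then 1 else 0

/-- In the state `s`, array `1` holds the coloring `φ`. -/
def HoldsColoring {n : ℕ} {G : SimpleGraph (Fin n)} (s : State) (φ : G.Coloring ℕ+) : Prop :=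
  ∀ v : Fin n, s.arr 1 (v : ℕ) = (φ v : ℕ)

end RAM

/-- On the graphs with the property `C`, the minimum entropy coloring problem can be approximated
in polynomial time within an additive error of `ε` bits: a single program, given any such graph
`G` on `n` vertices, halts within a number of steps polynomial in `n`, and outputs a proper
coloring whose entropy exceeds that of every proper coloring of `G` by at most `ε`. -/
def MinEntropyColoringApproxInPolyTime (C : ∀ n : ℕ, SimpleGraph (Fin n) → Prop) (ε : ℝ) : Prop :=
  ∃ (P : RAM.Prog) (T : Polynomial ℕ), ∀ (n : ℕ) (G : SimpleGraph (Fin n)), C n G →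
    ∃ (t : ℕ) (s : RAM.State) (φ : G.Coloring ℕ+),
      RAM.Exec P (RAM.graphInput G) t s ∧ t ≤ T.eval n ∧ RAM.HoldsColoring s φ ∧
        ∀ ψ : G.Coloring ℕ+, coloringEntropy φ ≤ coloringEntropy ψ + ε

/-!
# Minimum entropy coloring of interval graphs within one bit

Sort the intervals by their right endpoints. For every `k`, the greedy algorithm in this order,
which accepts an interval unless this puts a point into `k + 1` accepted intervals, finds a largest
subfamily of clique number at most `k` (`card_le_card_chosen`), and these subfamilies grow with `k`
(`chosen_subset_chosen_succ`). Let the `k`-th level be what the capacity `k` adds to the capacity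
`k - 1`. Each interval of a level has a point that lies in no other interval of this level, so that
only consecutive intervals of a level intersect (`not_adjacent_of_between`), and each level splits
into two color classes by parity. For every coloring `ψ`, the union of any `k` color classes of `ψ`
is at most as large as the union of the first `k` levels. Hence the entropy of the distribution of
the levels is at most that of `ψ`, and the splitting into two costs at most one bit
(`coloringEntropy_le_add_one`).

The order has to be found from the adjacency matrix. The pairs of disjoint intervals carry the
transitive orientation "to the left of". A transitive orientation of the nonadjacent pairs is
found by going through the pairs in lexicographic order, choosing the direction `(a, b)` for a pair
that has none, together with all the directions that this choice forces. The result is transitive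
(`IsPartialOrientation.no_triangle`); as an interval graph has no induced 4-cycle, the sets of
successors are nested (`IsPartialOrientation.nested`), and sorting by the number of successors gives
an order with the one property of the order of right endpoints that the greedy algorithm needs: if
`u < v < w` and `u`, `w` are adjacent, then `v`, `w` are adjacent.

The algorithm is written in a small language of arrays, finite sums and loops `for x < n`. Its
programs are compiled to the random access machine, and as all the loops have length `n`, the number
of steps is bounded by a polynomial that is read off the program (`RAM.Cmd.exec_prog`).
-/

/-! ### A language of arrays and bounded loops -/

namespace RAM

/-- `upto f a k` applies `f 0`, `f 1`, …, `f (k - 1)` to `a`, in this order. -/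
def upto {α : Type*} (f : ℕ → α → α) (a : α) : ℕ → α
  | 0 => a
  | k + 1 => f k (upto f a k)

theorem upto_induct {α : Type*} {f : ℕ → α → α} {a : α} {n : ℕ} (I : ℕ → α → Prop)
    (h0 : I 0 a) (hs : ∀ i b, i < n → I i b → I (i + 1) (f i b)) : I n (upto f a n) := by
  have : ∀ k, k ≤ n → I k (upto f a k) := by
    intro k
    induction k with
    | zero => exact fun _ => h0
    | succ k ih => exact fun hk => hs k _ (by omega) (ih (by omega))
  exact this n le_rfl

/-- Expressions over a memory of arrays, with named variables. The only bounds of summation are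
`0, …, n - 1`, where `n` is the size of the input. -/
inductive Tm : Type
  /-- the size `n` of the input -/
  | size : Tm
  /-- a constant -/
  | lit (k : ℕ) : Tm
  /-- a variable -/
  | var (x : ℕ) : Tm
  /-- `a + b` -/
  | add (a b : Tm) : Tm
  /-- `a - b`, truncated at zero -/
  | sub (a b : Tm) : Tm
  /-- the entry `A[a]` -/
  | load (A : ℕ) (a : Tm) : Tm
  /-- `a` if `c ≠ 0`, and `b` otherwise -/
  | ite (c a b : Tm) : Tm
  /-- `∑ x < n, a` -/
  | sum (x : ℕ) (a : Tm) : Tm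

/-- The value of an expression for the input size `n`, the memory `m` and the values `ρ` of the
variables. -/
def Tm.val (n : ℕ) (m : ℕ → ℕ → ℕ) : Tm → (ℕ → ℕ) → ℕ
  | size, _ => n
  | lit k, _ => k
  | var x, ρ => ρ x
  | add a b, ρ => a.val n m ρ + b.val n m ρ
  | sub a b, ρ => a.val n m ρ - b.val n m ρ
  | load A a, ρ => m A (a.val n m ρ)
  | ite c a b, ρ => if c.val n m ρ ≠ 0 then a.val n m ρ else b.val n m ρ
  | sum x a, ρ => ∑ i ∈ Finset.range n, a.val n m (Function.update ρ x i)

/-- Commands: assignments to array entries, and loops `for x < n` over them. Variables are only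
bound by loops, never assigned to. -/
inductive Cmd : Type
  /-- `A[a] := b` -/
  | put (A : ℕ) (a b : Tm) : Cmd
  /-- first `p`, then `q` -/
  | seq (p q : Cmd) : Cmd
  /-- `p` for `x = 0, …, n - 1` -/
  | loop (x : ℕ) (p : Cmd) : Cmd

/-- The effect of a command on the memory. -/
def Cmd.run (n : ℕ) : Cmd → (ℕ → ℕ) → (ℕ → ℕ → ℕ) → ℕ → ℕ → ℕ
  | put A a b, ρ, m => Function.update m A (Function.update (m A) (a.val n m ρ) (b.val n m ρ))
  | seq p q, ρ, m => q.run n ρ (p.run n ρ m)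
  | loop x p, ρ, m => upto (fun i m' => p.run n (Function.update ρ x i) m') m n

/-- A loop `for x < n`, where the variable `x` lives in the register `v`; the register `c` is
scratch space for the test, recomputed from `v`, so that the body may overwrite it. -/
def countLoop (v c : ℕ) (p : Prog) : Prog :=
  .seq (.const v 0) (.seq (.sub c 0 v)
    (.loop c (.seq p (.seq (.const c 1) (.seq (.add v v c) (.sub c 0 v))))))

/-- The program that evaluates an expression. The variable `x` lives in the register `2 x + 2`,
and the odd registers from `2 t + 1` on are scratch space, the first of which receives the
result. A sum saves the value that its variable had before. -/
def Tm.prog : Tm → ℕ → Prog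
  | size, t => .copy (2 * t + 1) 0
  | lit k, t => .const (2 * t + 1) k
  | var x, t => .copy (2 * t + 1) (2 * x + 2)
  | add a b, t => .seq (a.prog t) (.seq (b.prog (t + 1))
      (.add (2 * t + 1) (2 * t + 1) (2 * (t + 1) + 1)))
  | sub a b, t => .seq (a.prog t) (.seq (b.prog (t + 1))
      (.sub (2 * t + 1) (2 * t + 1) (2 * (t + 1) + 1)))
  | load A a, t => .seq (a.prog t) (.load (2 * t + 1) A (2 * t + 1))
  | ite c a b, t => .seq (c.prog t) (.cond (2 * t + 1) (a.prog t) (b.prog t))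
  | sum x a, t => .seq (.const (2 * t + 1) 0) (.seq (.copy (2 * (t + 1) + 1) (2 * x + 2))
      (.seq (countLoop (2 * x + 2) (2 * (t + 2) + 1)
        (.seq (a.prog (t + 2)) (.add (2 * t + 1) (2 * t + 1) (2 * (t + 2) + 1))))
        (.copy (2 * x + 2) (2 * (t + 1) + 1))))

/-- A bound for the number of steps of `Tm.prog`, as a polynomial in the input size. -/
noncomputable def Tm.cost : Tm → Polynomial ℕ
  | size => 1
  | lit _ => 1
  | var _ => 1
  | add a b => a.cost + b.cost + 1
  | sub a b => a.cost + b.cost + 1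
  | load _ a => a.cost + 1
  | ite c a b => c.cost + a.cost + b.cost + 1
  | sum _ a => 6 + Polynomial.X * (a.cost + 5)

/-- The program that carries out a command; its scratch registers are as in `Tm.prog`. -/
def Cmd.prog : Cmd → ℕ → Prog
  | put A a b, t => .seq (a.prog t) (.seq (b.prog (t + 1))
      (.store A (2 * t + 1) (2 * (t + 1) + 1)))
  | seq p q, t => .seq (p.prog t) (q.prog t)
  | loop x p, t => .seq (.copy (2 * t + 1) (2 * x + 2))
      (.seq (countLoop (2 * x + 2) (2 * (t + 1) + 1) (p.prog (t + 1)))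
        (.copy (2 * x + 2) (2 * t + 1)))

/-- A bound for the number of steps of `Cmd.prog`, as a polynomial in the input size. -/
noncomputable def Cmd.cost : Cmd → Polynomial ℕ
  | put _ a b => a.cost + b.cost + 1
  | seq p q => p.cost + q.cost
  | loop _ p => 5 + Polynomial.X * (p.cost + 4)

theorem reg_setReg_self (s : State) (a x : ℕ) : (s.setReg a x).reg a = x :=
  Function.update_self ..

theorem reg_setReg_of_ne {s : State} {a b x : ℕ} (h : b ≠ a) : (s.setReg a x).reg b = s.reg b :=
  Function.update_of_ne h ..

theorem exec_countLoop {v c n T : ℕ} {p : Prog} (I : ℕ → State → Prop) (hv : v ≠ 0) (hc : c ≠ 0)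
    (hvc : v ≠ c) (hIv : ∀ i s y, I i s → I i (s.setReg v y))
    (hIc : ∀ i s y, I i s → I i (s.setReg c y))
    (hp : ∀ i s, i < n → I i s → s.reg v = i → s.reg 0 = n →
      ∃ t s', Exec p s t s' ∧ t ≤ T ∧ s'.reg v = i ∧ s'.reg 0 = n ∧ I (i + 1) s')
    {s : State} (h0 : I 0 s) (hn : s.reg 0 = n) :
    ∃ t s', Exec (countLoop v c p) s t s' ∧ t ≤ 3 + n * (T + 4) ∧ s'.reg 0 = n ∧ I n s' := by
  have key : ∀ k i s, i + k = n → I i s → s.reg v = i → s.reg 0 = n → s.reg c = n - i →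
      ∃ t s', Exec (.loop c (.seq p (.seq (.const c 1) (.seq (.add v v c) (.sub c 0 v))))) s t s'
        ∧ t ≤ 1 + k * (T + 4) ∧ s'.reg 0 = n ∧ I n s' := by
    intro k
    induction k with
    | zero =>
      intro i s hi hI hsv hs0 hsc
      obtain rfl : i = n := by omega
      exact ⟨1, s, .loop_done (by omega), by omega, hs0, hI⟩
    | succ k ih =>
      intro i s hi hI hsv hs0 hsc
      obtain ⟨t, s₁, he, ht, h1v, h10, h1I⟩ := hp i s (by omega) hI hsv hs0
      have e1 := Exec.const s₁ c 1
      have e2 := Exec.add (s₁.setReg c 1) v v c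
      rw [reg_setReg_self, reg_setReg_of_ne hvc, h1v] at e2
      have e3 := Exec.sub ((s₁.setReg c 1).setReg v (i + 1)) c 0 v
      rw [reg_setReg_self, reg_setReg_of_ne hv.symm, reg_setReg_of_ne hc.symm, h10] at e3
      obtain ⟨t', s', he', ht', h'⟩ := ih (i + 1)
        (((s₁.setReg c 1).setReg v (i + 1)).setReg c (n - (i + 1))) (by omega)
        (hIc _ _ _ (hIv _ _ _ (hIc _ _ _ h1I)))
        (by rw [reg_setReg_of_ne hvc, reg_setReg_self])
        (by rw [reg_setReg_of_ne hc.symm, reg_setReg_of_ne hv.symm, reg_setReg_of_ne hc.symm, h10])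
        (reg_setReg_self ..)
      refine ⟨_, s', Exec.loop_step (by omega) (he.seq (e1.seq (e2.seq e3))) he', ?_, h'⟩
      rw [Nat.add_mul]
      omega
  have e1 := Exec.const s v 0
  have e2 := Exec.sub (s.setReg v 0) c 0 v
  rw [reg_setReg_self, reg_setReg_of_ne hv.symm, hn] at e2
  obtain ⟨t, s', he, ht, h'⟩ := key n 0 ((s.setReg v 0).setReg c (n - 0)) (by omega)
    (hIc _ _ _ (hIv _ _ _ h0)) (by rw [reg_setReg_of_ne hvc, reg_setReg_self])
    (by rw [reg_setReg_of_ne hc.symm, reg_setReg_of_ne hv.symm, hn]) (reg_setReg_self ..)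
  exact ⟨_, s', e1.seq (e2.seq he), by omega, h'⟩

/-- The state `s` stores the input size `n`, the values `ρ` of the variables and the memory
`m`. -/
def Stores (n : ℕ) (ρ : ℕ → ℕ) (m : ℕ → ℕ → ℕ) (s : State) : Prop :=
  s.reg 0 = n ∧ (∀ x, s.reg (2 * x + 2) = ρ x) ∧ s.arr = m

theorem Stores.of_frame {n t : ℕ} {ρ : ℕ → ℕ} {m m' : ℕ → ℕ → ℕ} {s s' : State}
    (h : Stores n ρ m s) (hf : ∀ y, y % 2 = 0 ∨ y < 2 * t + 1 → s'.reg y = s.reg y)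
    (hm : s'.arr = m') : Stores n ρ m' s' :=
  ⟨by rw [hf 0 (by omega), h.1], fun x => by rw [hf _ (by omega), h.2.1], hm⟩

theorem Tm.exec_prog {n : ℕ} {m : ℕ → ℕ → ℕ} (a : Tm) : ∀ (t : ℕ) (ρ : ℕ → ℕ) (s : State),
    Stores n ρ m s → ∃ k s', Exec (a.prog t) s k s' ∧ k ≤ a.cost.eval n ∧
      s'.reg (2 * t + 1) = a.val n m ρ ∧ s'.arr = m ∧
      ∀ y, y % 2 = 0 ∨ y < 2 * t + 1 → s'.reg y = s.reg y := by
  have frame : ∀ (t z : ℕ) (s : State) (y : ℕ), y % 2 = 0 ∨ y < 2 * t + 1 →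
      (s.setReg (2 * t + 1) z).reg y = s.reg y := by
    intro t z s y hy
    have : y ≠ 2 * t + 1 := by omega
    simp [State.setReg, this]
  induction a with
  | size =>
    intro t ρ s h
    exact ⟨1, _, .copy .., by simp [Tm.cost], by simp [State.setReg, Tm.val, h.1], h.2.2,
      frame t _ s⟩
  | lit k =>
    intro t ρ s h
    exact ⟨1, _, .const .., by simp [Tm.cost], by simp [State.setReg, Tm.val], h.2.2,
      frame t _ s⟩
  | var x =>
    intro t ρ s h
    exact ⟨1, _, .copy .., by simp [Tm.cost], by simp [State.setReg, Tm.val, h.2.1], h.2.2,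
      frame t _ s⟩
  | add a b iha ihb =>
    intro t ρ s h
    obtain ⟨k₁, s₁, e₁, c₁, v₁, m₁, f₁⟩ := iha t ρ s h
    obtain ⟨k₂, s₂, e₂, c₂, v₂, m₂, f₂⟩ := ihb (t + 1) ρ s₁ (h.of_frame f₁ m₁)
    refine ⟨_, _, e₁.seq (e₂.seq (.add ..)), by simp [Tm.cost]; omega, ?_, m₂, ?_⟩
    · simp [State.setReg, Tm.val, v₂, f₂ (2 * t + 1) (by omega), v₁]
    · intro y hy
      rw [frame t _ _ y hy, f₂ y (by omega), f₁ y hy]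
  | sub a b iha ihb =>
    intro t ρ s h
    obtain ⟨k₁, s₁, e₁, c₁, v₁, m₁, f₁⟩ := iha t ρ s h
    obtain ⟨k₂, s₂, e₂, c₂, v₂, m₂, f₂⟩ := ihb (t + 1) ρ s₁ (h.of_frame f₁ m₁)
    refine ⟨_, _, e₁.seq (e₂.seq (.sub ..)), by simp [Tm.cost]; omega, ?_, m₂, ?_⟩
    · simp [State.setReg, Tm.val, v₂, f₂ (2 * t + 1) (by omega), v₁]
    · intro y hy
      rw [frame t _ _ y hy, f₂ y (by omega), f₁ y hy]
  | load A a iha =>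
    intro t ρ s h
    obtain ⟨k₁, s₁, e₁, c₁, v₁, m₁, f₁⟩ := iha t ρ s h
    refine ⟨_, _, e₁.seq (.load ..), by simp [Tm.cost]; omega, ?_, m₁, ?_⟩
    · simp [State.setReg, Tm.val, v₁, m₁]
    · intro y hy
      rw [frame t _ _ y hy, f₁ y hy]
  | ite c a b ihc iha ihb =>
    intro t ρ s h
    obtain ⟨k₁, s₁, e₁, c₁, v₁, m₁, f₁⟩ := ihc t ρ s h
    by_cases hc : c.val n m ρ = 0
    · obtain ⟨k₂, s₂, e₂, c₂, v₂, m₂, f₂⟩ := ihb t ρ s₁ (h.of_frame f₁ m₁)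
      exact ⟨_, _, e₁.seq (.cond_false (by rw [v₁, hc]) e₂), by simp [Tm.cost]; omega,
        by simp [Tm.val, hc, v₂], m₂, fun y hy => by rw [f₂ y hy, f₁ y hy]⟩
    · obtain ⟨k₂, s₂, e₂, c₂, v₂, m₂, f₂⟩ := iha t ρ s₁ (h.of_frame f₁ m₁)
      exact ⟨_, _, e₁.seq (.cond_true (by rw [v₁]; exact hc) e₂), by simp [Tm.cost]; omega,
        by simp [Tm.val, hc, v₂], m₂, fun y hy => by rw [f₂ y hy, f₁ y hy]⟩
  | sum x a iha =>
    intro t ρ s h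
    obtain ⟨k, s', e, hk, h0, hI⟩ := exec_countLoop (v := 2 * x + 2) (c := 2 * (t + 2) + 1)
      (n := n) (T := a.cost.eval n + 1)
      (p := .seq (a.prog (t + 2)) (.add (2 * t + 1) (2 * t + 1) (2 * (t + 2) + 1)))
      (fun i s' => s'.arr = m ∧
        s'.reg (2 * t + 1) = ∑ j ∈ Finset.range i, a.val n m (Function.update ρ x j) ∧
        s'.reg (2 * (t + 1) + 1) = ρ x ∧
        ∀ y, y ≠ 2 * x + 2 → y % 2 = 0 ∨ y < 2 * t + 1 → s'.reg y = s.reg y)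
      (by omega) (by omega) (by omega)
      (by
        rintro i s' z ⟨h1, h2, h3, h4⟩
        refine ⟨h1, ?_, ?_, fun y hy hy' => ?_⟩
        · rw [← h2, reg_setReg_of_ne (by omega)]
        · rw [← h3, reg_setReg_of_ne (by omega)]
        · rw [← h4 y hy hy', reg_setReg_of_ne hy])
      (by
        rintro i s' z ⟨h1, h2, h3, h4⟩
        refine ⟨h1, ?_, ?_, fun y hy hy' => ?_⟩
        · rw [← h2, reg_setReg_of_ne (by omega)]
        · rw [← h3, reg_setReg_of_ne (by omega)]
        · rw [← h4 y hy hy', reg_setReg_of_ne (by omega)])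
      (by
        rintro i s' hi ⟨h1, h2, h3, h4⟩ hv h0
        obtain ⟨k₁, s₁, e₁, c₁, v₁, m₁, f₁⟩ := iha (t + 2) (Function.update ρ x i) s'
          ⟨h0, fun y => by
            rcases eq_or_ne y x with rfl | hy
            · simp [hv]
            · rw [h4 _ (by omega) (by omega), h.2.1, Function.update_of_ne hy], h1⟩
        refine ⟨_, _, e₁.seq (.add ..), by omega, ?_, ?_, m₁, ?_, ?_, fun y hy hy' => ?_⟩
        · rw [reg_setReg_of_ne (by omega), f₁ _ (by omega), hv]
        · rw [reg_setReg_of_ne (by omega), f₁ _ (by omega), h0]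
        · rw [reg_setReg_self, f₁ _ (by omega), h2, v₁, Finset.sum_range_succ]
        · rw [reg_setReg_of_ne (by omega), f₁ _ (by omega), h3]
        · rw [reg_setReg_of_ne (by omega), f₁ _ (by omega), h4 y hy hy'])
      (s := (s.setReg (2 * t + 1) 0).setReg (2 * (t + 1) + 1)
        ((s.setReg (2 * t + 1) 0).reg (2 * x + 2)))
      (by
        refine ⟨h.2.2, ?_, ?_, fun y hy hy' => ?_⟩
        · simp [State.setReg]
        · rw [reg_setReg_self, reg_setReg_of_ne (by omega), h.2.1]
        · rw [reg_setReg_of_ne (by omega), reg_setReg_of_ne (by omega)])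
      (by rw [reg_setReg_of_ne (by omega), reg_setReg_of_ne (by omega), h.1])
    obtain ⟨h1, h2, h3, h4⟩ := hI
    refine ⟨_, _, Exec.seq (.const ..) (.seq (.copy ..) (e.seq (.copy ..))), ?_, ?_, h1, ?_⟩
    · simp only [Tm.cost, Polynomial.eval_add, Polynomial.eval_mul, Polynomial.eval_X,
        Polynomial.eval_ofNat]
      have : n * (Polynomial.eval n a.cost + 1 + 4) = n * (Polynomial.eval n a.cost + 5) := by ring
      omega
    · rw [reg_setReg_of_ne (by omega), h2, Tm.val]
    · intro y hy
      rcases eq_or_ne y (2 * x + 2) with rfl | hne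
      · rw [reg_setReg_self, h3, h.2.1]
      · rw [reg_setReg_of_ne hne, h4 y hne hy]

theorem Cmd.exec_prog {n : ℕ} (p : Cmd) : ∀ (t : ℕ) (ρ : ℕ → ℕ) (m : ℕ → ℕ → ℕ) (s : State),
    Stores n ρ m s → ∃ k s', Exec (p.prog t) s k s' ∧ k ≤ p.cost.eval n ∧
      s'.arr = p.run n ρ m ∧ ∀ y, y % 2 = 0 ∨ y < 2 * t + 1 → s'.reg y = s.reg y := by
  induction p with
  | put A a b =>
    intro t ρ m s h
    obtain ⟨k₁, s₁, e₁, c₁, v₁, m₁, f₁⟩ := a.exec_prog t ρ s h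
    obtain ⟨k₂, s₂, e₂, c₂, v₂, m₂, f₂⟩ := b.exec_prog (t + 1) ρ s₁ (h.of_frame f₁ m₁)
    refine ⟨_, _, e₁.seq (e₂.seq (.store ..)), by simp [Cmd.cost]; omega, ?_, ?_⟩
    · simp only [State.setArr, Cmd.run]
      rw [m₂, v₂, f₂ (2 * t + 1) (by omega), v₁]
    · intro y hy
      rw [State.setArr, f₂ y (by omega), f₁ y hy]
  | seq p q ihp ihq =>
    intro t ρ m s h
    obtain ⟨k₁, s₁, e₁, c₁, m₁, f₁⟩ := ihp t ρ m s h
    obtain ⟨k₂, s₂, e₂, c₂, m₂, f₂⟩ := ihq t ρ _ s₁ (h.of_frame f₁ m₁)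
    exact ⟨_, _, e₁.seq e₂, by simp [Cmd.cost]; omega, m₂, fun y hy => by rw [f₂ y hy, f₁ y hy]⟩
  | loop x p ihp =>
    intro t ρ m s h
    obtain ⟨k, s', e, hk, h0, hI⟩ := exec_countLoop (v := 2 * x + 2) (c := 2 * (t + 1) + 1)
      (n := n) (T := p.cost.eval n) (p := p.prog (t + 1))
      (fun i s' => s'.arr = upto (fun i m' => p.run n (Function.update ρ x i) m') m i ∧
        s'.reg (2 * t + 1) = ρ x ∧
        ∀ y, y ≠ 2 * x + 2 → y % 2 = 0 ∨ y < 2 * t + 1 → s'.reg y = s.reg y)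
      (by omega) (by omega) (by omega)
      (by
        rintro i s' z ⟨h1, h2, h3⟩
        refine ⟨h1, ?_, fun y hy hy' => ?_⟩
        · rw [← h2, reg_setReg_of_ne (by omega)]
        · rw [← h3 y hy hy', reg_setReg_of_ne hy])
      (by
        rintro i s' z ⟨h1, h2, h3⟩
        refine ⟨h1, ?_, fun y hy hy' => ?_⟩
        · rw [← h2, reg_setReg_of_ne (by omega)]
        · rw [← h3 y hy hy', reg_setReg_of_ne (by omega)])
      (by
        rintro i s' hi ⟨h1, h2, h3⟩ hv h0
        obtain ⟨k₁, s₁, e₁, c₁, m₁, f₁⟩ := ihp (t + 1) (Function.update ρ x i) _ s'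
          ⟨h0, fun y => by
            rcases eq_or_ne y x with rfl | hy
            · simp [hv]
            · rw [h3 _ (by omega) (by omega), h.2.1, Function.update_of_ne hy], rfl⟩
        refine ⟨_, _, e₁, c₁, ?_, ?_, ?_, ?_, fun y hy hy' => ?_⟩
        · rw [f₁ _ (by omega), hv]
        · rw [f₁ _ (by omega), h0]
        · rw [m₁, h1, upto]
        · rw [f₁ _ (by omega), h2]
        · rw [f₁ _ (by omega), h3 y hy hy'])
      (s := s.setReg (2 * t + 1) (s.reg (2 * x + 2)))
      (by
        refine ⟨h.2.2, ?_, fun y hy hy' => ?_⟩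
        · rw [reg_setReg_self, h.2.1]
        · rw [reg_setReg_of_ne (by omega)])
      (by rw [reg_setReg_of_ne (by omega), h.1])
    obtain ⟨h1, h2, h3⟩ := hI
    refine ⟨_, _, Exec.seq (.copy ..) (e.seq (.copy ..)), ?_, h1, ?_⟩
    · simp only [Cmd.cost, Polynomial.eval_add, Polynomial.eval_mul, Polynomial.eval_X,
        Polynomial.eval_ofNat]
      omega
    · intro y hy
      rcases eq_or_ne y (2 * x + 2) with rfl | hne
      · rw [reg_setReg_self, h2, h.2.1]
      · rw [reg_setReg_of_ne hne, h3 y hne hy]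

end RAM

/-! ### The greedy algorithm for all capacities -/

section Greedy

open Classical in
/-- Positions `0, 1, 2, …` stand for intervals in the order of their right endpoints, and `K u x`
says that `u ≤ x` and that the interval `x` contains the right endpoint of `u`. `chosen K k w` is
the result of the greedy algorithm for a largest `k`-colorable subfamily on the positions below
`w`: a position is accepted unless one of the points that it contains is covered by `k` accepted
positions already. -/
noncomputable def chosen (K : ℕ → ℕ → Prop) (k : ℕ) : ℕ → Finset ℕ
  | 0 => ∅
  | w + 1 =>
    if ∀ u, K u w → ((chosen K k w).filter (K u)).card < k then insert w (chosen K k w)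
    else chosen K k w

variable {K : ℕ → ℕ → Prop} {k : ℕ}

theorem mem_chosen_iff {w x : ℕ} :
    x ∈ chosen K k w ↔ x < w ∧ x ∈ chosen K k (x + 1) := by
  induction w with
  | zero => simp [chosen]
  | succ w ih =>
    rcases eq_or_ne x w with rfl | hne
    · simp
    · have : x ∈ chosen K k (w + 1) ↔ x ∈ chosen K k w := by
        rw [chosen]
        split_ifs
        · simp [hne]
        · rfl
      rw [this]
      refine ih.trans (and_congr_left fun _ => ?_)
      omega

open Classical in
theorem mem_chosen_succ {x : ℕ} : x ∈ chosen K k (x + 1) ↔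
    ∀ u, K u x → ((chosen K k x).filter (K u)).card < k := by
  have hx : x ∉ chosen K k x := fun h => lt_irrefl _ (mem_chosen_iff.1 h).1
  rw [chosen]
  split_ifs with h
  · simp only [Finset.mem_insert_self, true_iff]
    exact h
  · simp only [hx, false_iff]
    exact h

theorem chosen_subset_of_le {v w : ℕ} (h : v ≤ w) : chosen K k v ⊆ chosen K k w := fun x hx => by
  rw [mem_chosen_iff] at hx ⊢
  exact ⟨by omega, hx.2⟩

theorem chosen_subset_range (w : ℕ) : chosen K k w ⊆ Finset.range w := fun _ hx =>
  Finset.mem_range.2 (mem_chosen_iff.1 hx).1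

open Classical in
theorem card_filter_chosen_le (u w : ℕ) : ((chosen K k w).filter (K u)).card ≤ k := by
  induction w with
  | zero => simp [chosen]
  | succ w ih =>
    rw [chosen]
    split_ifs with h
    · rw [Finset.filter_insert]
      split_ifs with hu
      · exact (Finset.card_insert_le _ _).trans (h u hu)
      · exact ih
    · exact ih

open Classical in
/-- If a point is covered by `k` positions of `chosen K k w`, then at most one of the positions
that are accepted for `k + 1` but not for `k` covers it. -/
theorem eq_of_saturated {w p x y : ℕ} (hsub : chosen K k w ⊆ chosen K (k + 1) w)
    (hp : k ≤ ((chosen K k w).filter (K p)).card)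
    (hx : x ∈ chosen K (k + 1) w) (hx' : x ∉ chosen K k w) (hpx : K p x)
    (hy : y ∈ chosen K (k + 1) w) (hy' : y ∉ chosen K k w) (hpy : K p y) : x = y := by
  by_contra hne
  have h1 : insert x (insert y ((chosen K k w).filter (K p))) ⊆
      (chosen K (k + 1) w).filter (K p) := by
    intro z hz
    simp only [Finset.mem_insert, Finset.mem_filter] at hz ⊢
    rcases hz with rfl | rfl | hz
    · exact ⟨hx, hpx⟩
    · exact ⟨hy, hpy⟩
    · exact ⟨hsub hz.1, hz.2⟩
  have h2 := (Finset.card_le_card h1).trans (card_filter_chosen_le p w)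
  rw [Finset.card_insert_of_notMem (by simp [hne, hx']),
    Finset.card_insert_of_notMem (by simp [hy'])] at h2
  omega

open Classical in
/-- A position that is rejected covers a saturated point. -/
theorem exists_saturated {w x : ℕ} (hxw : x < w) (hx : x ∉ chosen K k w) :
    ∃ p, K p x ∧ k ≤ ((chosen K k w).filter (K p)).card := by
  have h : x ∉ chosen K k (x + 1) := fun h => hx (mem_chosen_iff.2 ⟨hxw, h⟩)
  rw [mem_chosen_succ] at h
  push Not at h
  obtain ⟨p, hp, hk⟩ := h
  exact ⟨p, hp, hk.trans (Finset.card_le_card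
    (Finset.filter_subset_filter _ (chosen_subset_of_le hxw.le)))⟩

variable (hle : ∀ u x, K u x → u ≤ x) (hC : ∀ u v x, K u x → u ≤ v → v ≤ x → K v x)
include hle hC

open Classical in
/-- The greedy families are nested. If the position `w` were accepted for `k` and rejected for
`k + 1`, then at a point `u` of `w` there would be two positions accepted only for `k + 1`. The
points at which these were rejected for `k` come before `u`, as they are not in `w`, so that both
positions cover the later one of them. -/
theorem chosen_subset_chosen_succ (w : ℕ) : chosen K k w ⊆ chosen K (k + 1) w := by
  induction w with
  | zero => simp [chosen]
  | succ w ih =>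
    intro x hx
    rcases eq_or_ne x w with rfl | hne
    swap
    · have hx' := mem_chosen_iff.1 hx
      exact chosen_subset_of_le (Nat.le_succ w) (ih (mem_chosen_iff.2 ⟨by omega, hx'.2⟩))
    rw [mem_chosen_succ] at hx ⊢
    by_contra! h
    obtain ⟨u, hu, hcard⟩ := h
    have hk := hx u hu
    have hD : 1 < ((chosen K (k + 1) x).filter (K u) \ (chosen K k x).filter (K u)).card := by
      have := Finset.le_card_sdiff ((chosen K k x).filter (K u)) ((chosen K (k + 1) x).filter (K u))
      omega
    obtain ⟨y, hy, z, hz, hyz⟩ := Finset.one_lt_card.1 hD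
    have block : ∀ y ∈ (chosen K (k + 1) x).filter (K u) \ (chosen K k x).filter (K u),
        y ∈ chosen K (k + 1) x ∧ y ∉ chosen K k x ∧ u ≤ y ∧
          ∃ p, K p y ∧ p < u ∧ k ≤ ((chosen K k x).filter (K p)).card := by
      intro y hy
      simp only [Finset.mem_sdiff, Finset.mem_filter, not_and'] at hy
      obtain ⟨⟨h1, h2⟩, h3⟩ := hy
      have hyx := (mem_chosen_iff.1 h1).1
      obtain ⟨p, hp, hpk⟩ := exists_saturated hyx (h3 h2)
      refine ⟨h1, h3 h2, hle _ _ h2, p, hp, ?_, hpk⟩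
      by_contra! hup
      exact absurd (hx p (hC u p x hu hup ((hle _ _ hp).trans hyx.le))) (by omega)
    obtain ⟨hy1, hy2, huy, p, hpy, hpu, hpk⟩ := block y hy
    obtain ⟨hz1, hz2, huz, q, hqz, hqu, hqk⟩ := block z hz
    rcases le_total p q with hpq | hqp
    · exact hyz (eq_of_saturated ih hqk hy1 hy2 (hC p q y hpy hpq (by omega)) hz1 hz2 hqz)
    · exact hyz (eq_of_saturated ih hpk hy1 hy2 hpy hz1 hz2 (hC q p z hqz hqp (by omega)))

theorem chosen_mono {j k : ℕ} (h : j ≤ k) (w : ℕ) : chosen K j w ⊆ chosen K k w := by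
  induction k, h using Nat.le_induction with
  | base => exact subset_rfl
  | succ k _ ih => exact ih.trans (chosen_subset_chosen_succ hle hC w)

open Classical in
/-- The greedy algorithm is optimal, by an exchange argument: an optimal family that agrees with
the greedy one below `w` and does not contain the accepted position `w` can trade a later position
for `w`. -/
theorem card_le_card_chosen (n : ℕ) {S : Finset ℕ} (hS : S ⊆ Finset.range n)
    (hSk : ∀ u, (S.filter (K u)).card ≤ k) : S.card ≤ (chosen K k n).card := by
  have key : ∀ w ≤ n, ∃ S' : Finset ℕ, S' ⊆ Finset.range n ∧ (∀ u, (S'.filter (K u)).card ≤ k) ∧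
      S.card ≤ S'.card ∧ ∀ x < w, x ∈ S' ↔ x ∈ chosen K k w := by
    intro w
    induction w with
    | zero => exact fun _ => ⟨S, hS, hSk, le_rfl, by simp⟩
    | succ w ih =>
      intro hw
      obtain ⟨S', h1, h2, h3, h4⟩ := ih (by omega)
      have hlt : ∀ x < w, x ∈ chosen K k w ↔ x ∈ chosen K k (w + 1) := fun x hx => by
        rw [mem_chosen_iff, mem_chosen_iff (w := w + 1)]
        simp [hx, hx.trans (Nat.lt_succ_self w)]
      have hsub : chosen K k w ⊆ S' := fun x hx => (h4 x (mem_chosen_iff.1 hx).1).2 hx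
      by_cases hwS : w ∈ S'
      · refine ⟨S', h1, h2, h3, fun x hx => ?_⟩
        rcases Nat.lt_succ_iff_lt_or_eq.1 hx with hx | rfl
        · rw [h4 x hx, hlt x hx]
        · simp only [hwS, true_iff]
          rw [mem_chosen_succ]
          intro u hu
          have hwc : x ∉ chosen K k x := fun h => lt_irrefl _ (mem_chosen_iff.1 h).1
          have : insert x ((chosen K k x).filter (K u)) ⊆ S'.filter (K u) := by
            intro z hz
            simp only [Finset.mem_insert, Finset.mem_filter] at hz ⊢
            rcases hz with rfl | hz
            · exact ⟨hwS, hu⟩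
            · exact ⟨hsub hz.1, hz.2⟩
          have := (Finset.card_le_card this).trans (h2 u)
          rwa [Finset.card_insert_of_notMem (by simp [hwc])] at this
      by_cases hwc : w ∈ chosen K k (w + 1)
      swap
      · refine ⟨S', h1, h2, h3, fun x hx => ?_⟩
        rcases Nat.lt_succ_iff_lt_or_eq.1 hx with hx | rfl
        · rw [h4 x hx, hlt x hx]
        · simp [hwS, hwc]
      rw [mem_chosen_succ] at hwc
      have hins : ∀ u, ((insert w S').filter (K u)).card ≤ (S'.filter (K u)).card + 1 := fun u => by
        rw [Finset.filter_insert]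
        split_ifs
        · exact Finset.card_insert_le _ _
        · omega
      by_cases hv : ∀ u, ((insert w S').filter (K u)).card ≤ k
      · refine ⟨insert w S', ?_, hv, h3.trans (Finset.card_le_card (Finset.subset_insert _ _)), ?_⟩
        · exact Finset.insert_subset (Finset.mem_range.2 (by omega)) h1
        · intro x hx
          rcases Nat.lt_succ_iff_lt_or_eq.1 hx with hx | rfl
          · rw [← hlt x hx, ← h4 x hx]
            simp [hx.ne]
          · simp only [Finset.mem_insert_self, true_iff]
            exact mem_chosen_succ.2 hwc
      -- The first point `u` at which `w` exceeds the capacity: a later position that covers `u`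
      -- covers all points of `w` from `u` on.
      push Not at hv
      have hu := Nat.find_spec hv
      set u := Nat.find hv with hudef
      have huw : K u w := by
        by_contra hn
        rw [Finset.filter_insert, if_neg hn] at hu
        exact absurd (h2 u) (by omega)
      obtain ⟨x, hxS, hux, hwx⟩ : ∃ x ∈ S', K u x ∧ w < x := by
        by_contra! hno
        have : S'.filter (K u) ⊆ (chosen K k w).filter (K u) := by
          intro z hz
          rw [Finset.mem_filter] at hz ⊢
          have hzw := hno z hz.1 hz.2
          have : z ≠ w := by rintro rfl; exact hwS hz.1
          exact ⟨(h4 z (by omega)).1 hz.1, hz.2⟩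
        have h5 := Finset.card_le_card this
        have h6 := hwc u huw
        have h7 := hins u
        omega
      refine ⟨(insert w S').erase x, ?_, ?_, ?_, ?_⟩
      · exact (Finset.erase_subset _ _).trans
          (Finset.insert_subset (Finset.mem_range.2 (by omega)) h1)
      · intro v
        rw [Finset.filter_erase]
        by_cases hvx : K v x ∧ K v w
        · have : x ∈ (insert w S').filter (K v) := by simp [hxS, hvx.1]
          rw [Finset.card_erase_of_mem this]
          have h7 := hins v
          have h8 := h2 v
          omega
        · by_cases hvw : K v w
          · have hvu : v < u := by
              by_contra! huv
              exact hvx ⟨hC u v x hux huv ((hle _ _ hvw).trans hwx.le), hvw⟩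
            have := Nat.find_min hv hvu
            exact (Finset.card_le_card (Finset.erase_subset _ _)).trans (by omega)
          · rw [Finset.filter_insert, if_neg hvw]
            exact (Finset.card_le_card (Finset.erase_subset _ _)).trans (h2 v)
      · rw [Finset.card_erase_of_mem (by simp [hxS]), Finset.card_insert_of_notMem hwS]
        omega
      · intro z hz
        rcases Nat.lt_succ_iff_lt_or_eq.1 hz with hz | rfl
        · rw [← hlt z hz, ← h4 z hz]
          have h5 : z ≠ w := by omega
          have h6 : z ≠ x := by omega
          simp [h5, h6]
        · simp only [Finset.mem_erase, ne_eq, Finset.mem_insert_self, and_true]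
          exact iff_of_true (by omega) (mem_chosen_succ.2 hwc)
  obtain ⟨S', h1, -, h3, h4⟩ := key n le_rfl
  refine h3.trans (Finset.card_le_card fun x hx => ?_)
  exact (h4 x (Finset.mem_range.1 (h1 hx))).1 hx

omit hle hC in
theorem exists_mem_chosen (x : ℕ) : x ∈ chosen K (x + 1) (x + 1) := by
  classical
  rw [mem_chosen_succ]
  intro u _
  have := Finset.card_le_card ((Finset.filter_subset (K u) _).trans
    (chosen_subset_range (K := K) (k := x + 1) x))
  rw [Finset.card_range] at this
  omega

open Classical in
/-- The level of a position: the least `k` for which the greedy algorithm accepts it. -/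
noncomputable def level (K : ℕ → ℕ → Prop) (x : ℕ) : ℕ :=
  Nat.find (⟨_, exists_mem_chosen x⟩ : ∃ k, x ∈ chosen K k (x + 1))

theorem mem_chosen_iff_level {w x : ℕ} : x ∈ chosen K k w ↔ x < w ∧ level K x ≤ k := by
  classical
  rw [mem_chosen_iff]
  refine and_congr_right fun _ => ⟨fun h => Nat.find_min' _ h, fun h => ?_⟩
  exact chosen_mono hle hC h _ (Nat.find_spec (⟨_, exists_mem_chosen x⟩ :
    ∃ k, x ∈ chosen K k (x + 1)))

omit hle hC in
theorem level_le (x : ℕ) : level K x ≤ x + 1 := by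
  classical
  exact Nat.find_min' _ (exists_mem_chosen x)

omit hle hC in
theorem level_pos (hrefl : ∀ x, K x x) (x : ℕ) : 0 < level K x := by
  classical
  rw [level, Nat.find_pos, mem_chosen_succ]
  exact fun h => absurd (h x (hrefl x)) (by omega)

/-- Within a level only consecutive positions can be adjacent. Each position of the level `k + 1`
covers a point that is saturated for `k`, which no other position of the level covers. -/
theorem not_adjacent_of_between (hrefl : ∀ x, K x x) {x y z : ℕ} (hxy : x < y) (hyz : y < z)
    (hx : level K x = level K z) (hy : level K y = level K z) : ¬ K x z := by
  intro hxz
  obtain ⟨k, hk⟩ : ∃ k, level K z = k + 1 := ⟨level K z - 1, by have := level_pos hrefl z; omega⟩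
  have hmem : ∀ {v}, v ≤ z → level K v = level K z →
      v ∈ chosen K (k + 1) (z + 1) ∧ v ∉ chosen K k (z + 1) := by
    intro v hv hl
    rw [mem_chosen_iff_level hle hC, mem_chosen_iff_level hle hC]
    omega
  have hX := hmem (by omega) hx
  have hY := hmem (by omega) hy
  have hZ := hmem le_rfl rfl
  have hsub := chosen_subset_chosen_succ (k := k) hle hC (z + 1)
  obtain ⟨p, hpx, hp⟩ := exists_saturated (by omega) hX.2
  obtain ⟨q, hqy, hq⟩ := exists_saturated (by omega) hY.2
  have hpx' := hle _ _ hpx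
  have hqy' := hle _ _ hqy
  rcases le_or_gt x q with hxq | hqx
  · have := eq_of_saturated hsub hq hY.1 hY.2 hqy hZ.1 hZ.2 (hC x q z hxz hxq (by omega))
    omega
  rcases le_total q p with hqp | hpq
  · have := eq_of_saturated hsub hp hX.1 hX.2 hpx hY.1 hY.2 (hC q p y hqy hqp (by omega))
    omega
  · have := eq_of_saturated hsub hq hX.1 hX.2 (hC p q x hpx hpq (by omega)) hY.1 hY.2 hqy
    omega

end Greedy

/-! ### Transitive orientations and sorting -/

section Orientation

/-- For a symmetric relation `N`, `Forces N (u, v) (u', v')` says that the pairs are related by `N`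
and share their first or their second entry, while the other two entries are not related. A
transitive orientation of `N` that contains the first pair then has to contain the second. -/
def Forces (N : ℕ → ℕ → Prop) (e e' : ℕ × ℕ) : Prop :=
  N e.1 e.2 ∧ N e'.1 e'.2 ∧ ((e.1 = e'.1 ∧ ¬ N e.2 e'.2) ∨ (e.2 = e'.2 ∧ ¬ N e.1 e'.1))

/-- The pairs that are forced by a pair, directly or indirectly. -/
abbrev ForcesStar (N : ℕ → ℕ → Prop) : ℕ × ℕ → ℕ × ℕ → Prop :=
  Relation.ReflTransGen (Forces N)

variable {N O : ℕ → ℕ → Prop}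

theorem Forces.symm (hN : ∀ u v, N u v → N v u) {e e' : ℕ × ℕ} (h : Forces N e e') :
    Forces N e' e := by
  obtain ⟨h1, h2, h3⟩ := h
  refine ⟨h2, h1, ?_⟩
  rcases h3 with ⟨h3, h4⟩ | ⟨h3, h4⟩
  · exact .inl ⟨h3.symm, fun h => h4 (hN _ _ h)⟩
  · exact .inr ⟨h3.symm, fun h => h4 (hN _ _ h)⟩

theorem Forces.swap (hN : ∀ u v, N u v → N v u) {e e' : ℕ × ℕ} (h : Forces N e e') :
    Forces N e.swap e'.swap :=
  ⟨hN _ _ h.1, hN _ _ h.2.1, h.2.2.symm⟩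

theorem ForcesStar.symm (hN : ∀ u v, N u v → N v u) {e e' : ℕ × ℕ} (h : ForcesStar N e e') :
    ForcesStar N e' e := by
  induction h with
  | refl => exact .refl
  | tail _ h ih => exact .head (h.symm hN) ih

theorem ForcesStar.swap (hN : ∀ u v, N u v → N v u) {e e' : ℕ × ℕ} (h : ForcesStar N e e') :
    ForcesStar N e.swap e'.swap := by
  induction h with
  | refl => exact .refl
  | tail _ h ih => exact .tail ih (h.swap hN)

theorem ForcesStar.mem {P : ℕ × ℕ → Prop} (hP : ∀ e e', P e → Forces N e e' → P e') {e e' : ℕ × ℕ}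
    (h : ForcesStar N e e') (he : P e) : P e' := by
  induction h with
  | refl => exact he
  | tail _ h ih => exact hP _ _ ih h

/-- `O` chooses at most one direction for the pairs related by `N`, and respects `Forces`. -/
structure IsPartialOrientation (N O : ℕ → ℕ → Prop) : Prop where
  rel : ∀ u v, O u v → N u v
  asymm : ∀ u v, O u v → ¬ O v u
  closed : ∀ e e' : ℕ × ℕ, O e.1 e.2 → Forces N e e' → O e'.1 e'.2
  /-- some pair forced by a given one begins with a vertex that comes before both entries -/
  lead : ∀ p q, O p q → ∃ x y, ForcesStar N (p, q) (x, y) ∧ x ≤ p ∧ x ≤ q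

/-- A pair `(x, y)` in a directed triangle can be replaced by all the pairs that it forces. -/
theorem IsPartialOrientation.triangle (hO : IsPartialOrientation N O) (hN : ∀ u v, N u v → N v u)
    {x y b : ℕ} {e : ℕ × ℕ} (h : ForcesStar N (x, y) e) (hxy : O x y) (hyb : O y b) (hbx : O b x) :
    O e.1 e.2 ∧ O e.2 b ∧ O b e.1 := by
  induction h with
  | refl => exact ⟨hxy, hyb, hbx⟩
  | @tail e e' _ h ih =>
    obtain ⟨x, y⟩ := e
    obtain ⟨x', y'⟩ := e'
    obtain ⟨h1, h2, h3⟩ := ih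
    have h' := hO.closed _ _ h1 h
    refine ⟨h', ?_⟩
    obtain ⟨n1, n2, ⟨rfl, n3⟩ | ⟨rfl, n3⟩⟩ := h
    · refine ⟨?_, h3⟩
      have n4 : N y' b := by
        by_contra n4
        exact hO.asymm _ _ h3 (hO.closed (_, _) (_, _) h' ⟨n2, hN _ _ (hO.rel _ _ h3),
          .inl ⟨rfl, n4⟩⟩)
      exact hO.closed (_, _) (_, _) h2 ⟨hO.rel _ _ h2, n4, .inr ⟨rfl, n3⟩⟩
    · refine ⟨h2, ?_⟩
      have n4 : N b x' := by
        by_contra n4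
        exact hO.asymm _ _ h2 (hO.closed (_, _) (_, _) h' ⟨n2, hN _ _ (hO.rel _ _ h2),
          .inr ⟨rfl, fun h => n4 (hN _ _ h)⟩⟩)
      exact hO.closed (_, _) (_, _) h3 ⟨hO.rel _ _ h3, n4, .inl ⟨rfl, n3⟩⟩

/-- There is no directed triangle: let `a` be the least vertex that lies on one. The pair `(c, a)`
forces some pair `(x, y)` with `x ≤ a`, and the triangle `x, y, b` contradicts the choice of `a`
or contains `(a, b)` reversed. -/
theorem IsPartialOrientation.no_triangle (hO : IsPartialOrientation N O)
    (hN : ∀ u v, N u v → N v u) (a : ℕ) : ∀ b c, O a b → O b c → O c a → False := by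
  induction a using Nat.strong_induction_on with
  | _ a ih =>
    intro b c hab hbc hca
    obtain ⟨x, y, hxy, hxc, hxa⟩ := hO.lead c a hca
    obtain ⟨h1, h2, h3⟩ := hO.triangle hN hxy hca hab hbc
    rcases hxa.lt_or_eq with hx | rfl
    · exact ih x hx y b h1 h2 h3
    · exact hO.asymm _ _ hab h3

theorem IsPartialOrientation.trans (hO : IsPartialOrientation N O) (hN : ∀ u v, N u v → N v u)
    (htot : ∀ u v, N u v → O u v ∨ O v u) {a b c : ℕ} (hab : O a b) (hbc : O b c) : O a c := by
  by_cases hac : N a c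
  · exact (htot a c hac).resolve_right fun hca => hO.no_triangle hN a b c hab hbc hca
  · exact absurd (hO.closed (_, _) (_, _) hab
      ⟨hO.rel _ _ hab, hN _ _ (hO.rel _ _ hbc), .inr ⟨rfl, hac⟩⟩) (hO.asymm _ _ hbc)

/-- The sets of successors are nested if the complement of `N` has no induced 4-cycle. -/
theorem IsPartialOrientation.nested (hO : IsPartialOrientation N O) (hN : ∀ u v, N u v → N v u)
    (htot : ∀ u v, N u v → O u v ∨ O v u)
    (hC4 : ∀ a b c d, N a b → N c d → N a c ∨ N a d ∨ N b c ∨ N b d) {a b c d : ℕ}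
    (hab : O a b) (hcd : O c d) : O a d ∨ O c b := by
  by_contra! hn
  obtain ⟨had, hcb⟩ := hn
  have tr := fun {a b c} => hO.trans (a := a) (b := b) (c := c) hN htot
  have nab := hO.rel _ _ hab
  have ncd := hO.rel _ _ hcd
  have nad : ¬ N a d := fun h => by
    rcases htot _ _ h with h | h
    · exact had h
    · exact hcb (tr hcd (tr h hab))
  have nbc : ¬ N b c := fun h => by
    rcases htot _ _ h with h | h
    · exact had (tr hab (tr h hcd))
    · exact hcb h
  have nac : ¬ N a c := fun h =>
    had (tr (hO.closed (_, _) (_, _) hab ⟨nab, h, .inl ⟨rfl, nbc⟩⟩) hcd)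
  have nbd : ¬ N b d := fun h =>
    hcb (tr hcd (hO.closed (_, _) (_, _) hab ⟨nab, hN _ _ h, .inr ⟨rfl, nad⟩⟩))
  rcases hC4 _ _ _ _ nab ncd with h | h | h | h <;> contradiction

/-- One round of the construction of an orientation: if neither direction of the pair `(a, b)` has
been chosen, then the direction `(a, b)` is chosen together with all that it forces. Pairs
with an entry below `a` have been dealt with. `F` is any orientation that respects `Forces`;
it shows that the forced pairs do not contradict each other. -/
theorem IsPartialOrientation.extend (hO : IsPartialOrientation N O) (hN : ∀ u v, N u v → N v u)
    {F : ℕ → ℕ → Prop} (hF : ∀ u v, F u v → ¬ F v u) (hFN : ∀ u v, N u v → F u v ∨ F v u)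
    (hFc : ∀ e e' : ℕ × ℕ, F e.1 e.2 → Forces N e e' → F e'.1 e'.2)
    {a b : ℕ} (hab : N a b) (hba : ¬ O b a) (hdone : ∀ p q, p < a → N p q → O p q ∨ O q p) :
    IsPartialOrientation N fun p q => O p q ∨ ForcesStar N (a, b) (p, q) where
  rel := by
    rintro u v (h | h)
    · exact hO.rel _ _ h
    · exact h.mem (P := fun e => N e.1 e.2) (fun _ _ _ h => h.2.1) hab
  asymm := by
    have mixed : ∀ u v, O u v → ¬ ForcesStar N (a, b) (v, u) := fun u v h h' =>
      hba ((h'.symm hN).swap hN |>.mem (P := fun e => O e.1 e.2) hO.closed h)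
    rintro u v (h | h) (h' | h')
    · exact hO.asymm _ _ h h'
    · exact mixed _ _ h h'
    · exact mixed _ _ h' h
    · have mem := fun {e e'} (h : ForcesStar N e e') => h.mem (P := fun e => F e.1 e.2) hFc
      rcases hFN _ _ hab with hf | hf
      · exact hF _ _ (mem h hf) (mem h' hf)
      · exact hF _ _ (mem (h.swap hN) hf) (mem (h'.swap hN) hf)
  closed := by
    rintro e e' (h | h) hf
    · exact .inl (hO.closed _ _ h hf)
    · exact .inr (h.tail hf)
  lead := by
    rintro p q (h | h)
    · exact hO.lead _ _ h
    by_cases hOab : O a b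
    · exact hO.lead _ _ (h.mem (P := fun e => O e.1 e.2) hO.closed hOab)
    have hpq : N p q := h.mem (P := fun e => N e.1 e.2) (fun _ _ _ h => h.2.1) hab
    have h1 : ¬ O p q := fun h' =>
      hOab ((h.symm hN).mem (P := fun e => O e.1 e.2) hO.closed h')
    have h2 : ¬ O q p := fun h' =>
      hba (((h.symm hN).swap hN).mem (P := fun e => O e.1 e.2) hO.closed h')
    refine ⟨a, b, h.symm hN, ?_, ?_⟩
    · by_contra! hlt
      rcases hdone p q hlt hpq with h | h <;> contradiction
    · by_contra! hlt
      rcases hdone q p hlt (hN _ _ hpq) with h | h <;> contradiction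

end Orientation

section Positions

variable {n : ℕ} (B : ℕ → ℕ → Prop)

open Classical in
/-- The position of `v` in the list of the numbers below `n`, sorted by the relation `B`. -/
noncomputable def position (n : ℕ) (v : ℕ) : ℕ := ((Finset.range n).filter fun u => B u v).card

variable {B} (htr : ∀ u v w, B u v → B v w → B u w) (hirr : ∀ u, ¬ B u u)
include htr hirr

theorem position_lt_position {u v : ℕ} (hu : u < n) (h : B u v) :
    position B n u < position B n v := by
  classical
  refine Finset.card_lt_card (Finset.ssubset_iff_of_subset ?_ |>.2 ⟨u, ?_, ?_⟩)
  · intro w hw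
    rw [Finset.mem_filter] at hw ⊢
    exact ⟨hw.1, htr _ _ _ hw.2 h⟩
  · simp [hu, h]
  · simp [hirr]

omit htr in
theorem position_lt {u : ℕ} (hu : u < n) : position B n u < n := by
  classical
  rw [position]
  conv_rhs => rw [← Finset.card_range n]
  refine Finset.card_lt_card (Finset.filter_ssubset.2 ⟨u, ?_, hirr u⟩)
  simpa using hu

variable (htot : ∀ u v, u ≠ v → B u v ∨ B v u)
include htot

theorem position_injOn : Set.InjOn (position B n) (Finset.range n) := by
  intro u hu v hv h
  by_contra hne
  rw [Finset.coe_range, Set.mem_Iio] at hu hv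
  rcases htot u v hne with h' | h'
  · exact absurd (position_lt_position htr hirr hu h') (by omega)
  · exact absurd (position_lt_position htr hirr hv h') (by omega)

theorem exists_position_eq {i : ℕ} (hi : i < n) : ∃ v < n, position B n v = i := by
  have h : (Finset.range n).image (position B n) = Finset.range n := by
    refine Finset.eq_of_subset_of_card_le ?_ ?_
    · intro j hj
      obtain ⟨u, hu, rfl⟩ := Finset.mem_image.1 hj
      exact Finset.mem_range.2 (position_lt hirr (Finset.mem_range.1 hu))
    · rw [Finset.card_image_of_injOn (position_injOn htr hirr htot)]
  have := Finset.mem_range.2 hi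
  rw [← h, Finset.mem_image] at this
  simpa using this

theorem rel_of_position_lt {u v : ℕ} (hv : v < n) (h : position B n u < position B n v) :
    B u v := by
  rcases eq_or_ne u v with rfl | hne
  · omega
  · refine (htot u v hne).resolve_right fun h' => ?_
    exact absurd (position_lt_position htr hirr hv h') (by omega)

end Positions

/-! ### Entropy and domination -/

section Entropy

variable {V : Type*} [Fintype V]

theorem coloringEntropy_eq {G : SimpleGraph V} (φ : G.Coloring ℕ+) :
    coloringEntropy φ =
      -(∑ v, Real.logb 2 (colorFraction φ (φ v))) / (Fintype.card V : ℝ) := by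
  classical
  rw [coloringEntropy, neg_div, Finset.sum_div]
  congr 1
  rw [← Finset.sum_fiberwise_of_maps_to (s := Finset.univ) (t := Finset.univ.image φ) (g := φ)
    (fun v hv => Finset.mem_image_of_mem φ hv)]
  refine Finset.sum_congr rfl fun i _ => ?_
  rw [Finset.sum_congr rfl (g := fun _ => Real.logb 2 (colorFraction φ i) / (Fintype.card V : ℝ))]
  · rw [Finset.sum_const, nsmul_eq_mul]
    conv_lhs => rw [colorFraction]
    rw [div_mul_eq_mul_div, mul_div_assoc]
    congr!
  · intro v hv
    rw [(Finset.mem_filter.1 hv).2]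

theorem colorFraction_pos {G : SimpleGraph V} (φ : G.Coloring ℕ+) (v : V) :
    0 < colorFraction φ (φ v) := by
  have : Nonempty V := ⟨v⟩
  refine div_pos ?_ (by exact_mod_cast Fintype.card_pos)
  exact_mod_cast Finset.card_pos.2 ⟨v, by simp⟩

/-- Gibbs' inequality: the entropy is at most the cross entropy with respect to any `q` of total
mass at most one. -/
theorem coloringEntropy_le_crossEntropy [Nonempty V] {G : SimpleGraph V} (φ : G.Coloring ℕ+)
    {q : ℕ+ → ℝ} (hq : ∀ v, 0 < q (φ v)) (hsum : ∑ i ∈ Finset.univ.image φ, q i ≤ 1) :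
    coloringEntropy φ ≤ -(∑ v, Real.logb 2 (q (φ v))) / (Fintype.card V : ℝ) := by
  classical
  have hN : (0 : ℝ) < Fintype.card V := by exact_mod_cast Fintype.card_pos
  rw [coloringEntropy_eq]
  refine div_le_div_of_nonneg_right (neg_le_neg ?_) hN.le
  simp only [Real.logb, ← Finset.sum_div]
  refine div_le_div_of_nonneg_right ?_ (Real.log_nonneg (by norm_num))
  rw [← sub_nonpos, ← Finset.sum_sub_distrib]
  have h1 : ∀ v ∈ Finset.univ, Real.log (q (φ v)) - Real.log (colorFraction φ (φ v)) ≤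
      q (φ v) / colorFraction φ (φ v) - 1 := fun v _ => by
    rw [← Real.log_div (hq v).ne' (colorFraction_pos φ v).ne']
    exact Real.log_le_sub_one_of_pos (div_pos (hq v) (colorFraction_pos φ v))
  refine (Finset.sum_le_sum h1).trans ?_
  rw [Finset.sum_sub_distrib, sub_nonpos, Finset.sum_const, nsmul_eq_mul, mul_one,
    Finset.card_univ, ← Finset.sum_fiberwise_of_maps_to (s := Finset.univ)
    (t := Finset.univ.image φ) (g := φ) (fun v hv => Finset.mem_image_of_mem φ hv)]
  have h2 : ∀ i ∈ Finset.univ.image φ, (∑ v ∈ Finset.univ.filter (fun v => φ v = i),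
      q (φ v) / colorFraction φ (φ v)) = Fintype.card V * q i := by
    intro i hi
    obtain ⟨w, -, rfl⟩ := Finset.mem_image.1 hi
    rw [Finset.sum_congr rfl (g := fun _ => q (φ w) / colorFraction φ (φ w))]
    · rw [Finset.sum_const, nsmul_eq_mul]
      have h3 := colorFraction_pos φ w
      rw [colorFraction] at h3 ⊢
      have h4 : (0 : ℝ) < ((Finset.univ.filter fun v => φ v = φ w).card : ℝ) :=
        (div_pos_iff_of_pos_right hN).1 h3
      field_simp
    · intro v hv
      rw [(Finset.mem_filter.1 hv).2]
  rw [Finset.sum_congr rfl h2, ← Finset.mul_sum]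
  exact mul_le_of_le_one_right hN.le hsum

open Classical in
/-- If `f` takes small values at least as often as `f'`, then its sum of values of an increasing
function `g` is at most that of `f'`. -/
theorem sum_comp_le_sum_comp {M : ℕ} {g : ℕ → ℝ} (hg : ∀ k, k + 1 < M → g k ≤ g (k + 1))
    {f f' : V → ℕ} (hf : ∀ v, f v < M) (hf' : ∀ v, f' v < M)
    (h : ∀ m ≤ M, (Finset.univ.filter fun v => f' v < m).card ≤
      (Finset.univ.filter fun v => f v < m).card) :
    ∑ v, g (f v) ≤ ∑ v, g (f' v) := by
  have cake : ∀ f : V → ℕ, (∀ v, f v < M) → ∑ v, g (f v) = ∑ _v : V, g 0 +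
      ∑ k ∈ Finset.range (M - 1),
        (g (k + 1) - g k) * (Finset.univ.filter fun v => ¬ f v < k + 1).card := by
    intro f hf
    have : ∀ v, g (f v) = g 0 + ∑ k ∈ Finset.range (M - 1),
        if ¬ f v < k + 1 then g (k + 1) - g k else 0 := by
      intro v
      rw [← Finset.sum_filter]
      have : (Finset.range (M - 1)).filter (fun k => ¬ f v < k + 1) = Finset.range (f v) := by
        ext k
        have := hf v
        simp only [Finset.mem_filter, Finset.mem_range]
        omega
      rw [this, Finset.sum_range_sub]
      ring
    rw [Finset.sum_congr rfl fun v _ => this v, Finset.sum_add_distrib, Finset.sum_comm]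
    congr 1
    refine Finset.sum_congr rfl fun k _ => ?_
    rw [← Finset.sum_filter, Finset.sum_const, nsmul_eq_mul, mul_comm]
  rw [cake f hf, cake f' hf']
  refine add_le_add le_rfl (Finset.sum_le_sum fun k hk => ?_)
  rw [Finset.mem_range] at hk
  refine mul_le_mul_of_nonneg_left ?_ (sub_nonneg.2 (hg k (by omega)))
  have h1 := h (k + 1) (by omega)
  have h2 := Finset.card_filter_add_card_filter_not (s := (Finset.univ : Finset V))
    (fun v => f v < k + 1)
  have h3 := Finset.card_filter_add_card_filter_not (s := (Finset.univ : Finset V))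
    (fun v => f' v < k + 1)
  exact_mod_cast (by omega)

open Classical in
/-- The color classes, enumerated by decreasing size. -/
theorem exists_enum_classes {G : SimpleGraph V} (ψ : G.Coloring ℕ+) :
    ∃ (C : Finset ℕ+) (e : Fin C.card ≃ C), (∀ c, c ∈ C ↔ ∃ v, ψ v = c) ∧
      ∀ i j, i ≤ j → colorFraction ψ (e j) ≤ colorFraction ψ (e i) := by
  set C := Finset.univ.image ψ
  set e₀ := C.equivFin.symm
  set f : Fin C.card → ℝ := fun i => -colorFraction ψ (e₀ i)
  refine ⟨C, (Tuple.sort f).trans e₀, by simp [C], fun i j hij => ?_⟩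
  exact neg_le_neg_iff.1 (Tuple.monotone_sort f hij)

/-- Splitting each weight `b j` into halves for the colors `2 (j + 1)` and `2 (j + 1) + 1` does not
increase the total weight. -/
theorem sum_half_le {b : ℕ → ℝ} (hb : ∀ i, 0 ≤ b i) {M : ℕ} {I : Finset ℕ+}
    (hI : ∀ i ∈ I, 2 ≤ (i : ℕ) ∧ (i : ℕ) / 2 - 1 < M) :
    ∑ i ∈ I, b ((i : ℕ) / 2 - 1) / 2 ≤ ∑ j ∈ Finset.range M, b j := by
  have himg : (I.image fun i : ℕ+ => (i : ℕ)) ⊆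
      (Finset.range M ×ˢ Finset.range 2).image fun x => 2 * (x.1 + 1) + x.2 := by
    intro i hi
    obtain ⟨c, hc, rfl⟩ := Finset.mem_image.1 hi
    have h := hI c hc
    refine Finset.mem_image.2 ⟨((c : ℕ) / 2 - 1, c % 2), ?_, ?_⟩
    · simp only [Finset.mem_product, Finset.mem_range]
      omega
    · simp only
      omega
  calc ∑ i ∈ I, b ((i : ℕ) / 2 - 1) / 2
      = ∑ i ∈ I.image fun i : ℕ+ => (i : ℕ), b (i / 2 - 1) / 2 := by
        rw [Finset.sum_image fun x _ y _ h => PNat.coe_injective h]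
    _ ≤ ∑ i ∈ (Finset.range M ×ˢ Finset.range 2).image
          fun x => 2 * (x.1 + 1) + x.2, b (i / 2 - 1) / 2 :=
        Finset.sum_le_sum_of_subset_of_nonneg himg fun i _ _ => div_nonneg (hb _) zero_le_two
    _ = ∑ x ∈ Finset.range M ×ˢ Finset.range 2, b x.1 / 2 := by
        rw [Finset.sum_image]
        · refine Finset.sum_congr rfl fun x hx => ?_
          simp only [Finset.mem_product, Finset.mem_range] at hx
          congr 2
          omega
        · rintro ⟨x, y⟩ hx ⟨x', y'⟩ hx' h
          simp only [Finset.coe_product, Finset.coe_range, Set.mem_prod, Set.mem_Iio] at hx hx' h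
          rw [Prod.mk.injEq]
          omega
    _ = ∑ j ∈ Finset.range M, b j := by
        rw [Finset.sum_product]
        simp only [Finset.sum_const, Finset.card_range, nsmul_eq_mul, Nat.cast_ofNat]
        refine Finset.sum_congr rfl fun i _ => by ring

open Classical in
/-- A coloring that splits each level of `lev` into at most two classes has entropy at most one bit
more than `ψ`, if the first `m` levels contain at least as many vertices as any `m` classes of
`ψ`, for all `m`. The colorings are compared through the cross entropy with respect to the
distribution that gives each color of the level `k` half the weight of the `k`-th largest class
of `ψ`. -/
theorem coloringEntropy_le_add_one {G : SimpleGraph V} (φ ψ : G.Coloring ℕ+) (lev : V → ℕ)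
    (hpos : ∀ v, 0 < lev v) (hφ : ∀ v, (φ v : ℕ) / 2 = lev v)
    (hdom : ∀ T : Finset ℕ+, (Finset.univ.filter fun v => ψ v ∈ T).card ≤
      (Finset.univ.filter fun v => lev v ≤ T.card).card) :
    coloringEntropy φ ≤ coloringEntropy ψ + 1 := by
  rcases isEmpty_or_nonempty V with hV | hV
  · simp [coloringEntropy]
  have hN : (0 : ℝ) < Fintype.card V := by exact_mod_cast Fintype.card_pos
  obtain ⟨C, e, hC, he⟩ := exists_enum_classes ψ
  have hψC : ∀ v, ψ v ∈ C := fun v => (hC _).2 ⟨v, rfl⟩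
  set b : ℕ → ℝ := fun i => if h : i < C.card then colorFraction ψ (e ⟨i, h⟩) else 0 with hb
  have hbe : ∀ (i : ℕ) (h : i < C.card), b i = colorFraction ψ (e ⟨i, h⟩) := fun i h => dif_pos h
  have hbpos : ∀ i < C.card, 0 < b i := by
    intro i hi
    simp only [hb, hi, dif_pos]
    obtain ⟨v, hv⟩ := (hC _).1 (e ⟨i, hi⟩).2
    rw [← hv]
    exact colorFraction_pos ψ v
  have hbnn : ∀ i, 0 ≤ b i := fun i => by
    by_cases hi : i < C.card
    · exact (hbpos i hi).le
    · simp [hb, hi]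
  set rank : V → ℕ := fun v => e.symm ⟨ψ v, hψC v⟩
  have hrank : ∀ v, rank v < C.card := fun v => (e.symm _).2
  have hbrank : ∀ v, b (rank v) = colorFraction ψ (ψ v) := by
    intro v
    simp only [hb, hrank, dif_pos]
    congr
    simp [rank]
  have hlev : ∀ v, lev v - 1 < C.card := by
    intro v
    have h1 := hdom C
    simp only [hψC, Finset.filter_true] at h1
    have h2 := Finset.eq_of_subset_of_card_le (Finset.filter_subset _ _) h1
    have h3 : v ∈ Finset.univ.filter fun v => lev v ≤ C.card := by
      rw [h2]
      exact Finset.mem_univ v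
    have h4 := (Finset.mem_filter.1 h3).2
    have := hpos v
    omega
  have hsumb : ∑ i ∈ Finset.range C.card, b i = 1 := by
    rw [Finset.sum_range]
    have : ∀ i : Fin C.card, b i = colorFraction ψ (e i) := fun i => by simp [hb]
    rw [Finset.sum_congr rfl fun i _ => this i, e.sum_comp (fun c => colorFraction ψ c),
      Finset.sum_coe_sort C (fun c => colorFraction ψ c)]
    simp only [colorFraction]
    rw [← Finset.sum_div, div_eq_one_iff_eq hN.ne']
    have := Finset.card_eq_sum_card_fiberwise (f := ψ) (s := Finset.univ) (t := C)
      (fun v _ => hψC v)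
    rw [Finset.card_univ] at this
    exact_mod_cast this.symm
  have hcross := coloringEntropy_le_crossEntropy φ (q := fun i => b ((i : ℕ) / 2 - 1) / 2)
    (fun v => by
      simp only [hφ]
      exact half_pos (hbpos _ (hlev v)))
    ((sum_half_le hbnn fun i hi => by
      obtain ⟨v, -, rfl⟩ := Finset.mem_image.1 hi
      have h1 := hlev v
      have h2 := hpos v
      have h3 := hφ v
      omega).trans hsumb.le)
  have hle := sum_comp_le_sum_comp (V := V) (M := C.card) (g := fun i => -Real.logb 2 (b i))
    (f := fun v => lev v - 1) (f' := rank)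
    (fun k hk => by
      refine neg_le_neg (Real.logb_le_logb_of_le (by norm_num) (hbpos _ hk) ?_)
      rw [hbe k (by omega), hbe (k + 1) hk]
      exact he ⟨k, by omega⟩ ⟨k + 1, hk⟩ (Fin.mk_le_mk.2 (Nat.le_succ k)))
    hlev hrank
    (fun m hm => by
      set T : Finset ℕ+ := (Finset.univ.filter fun i : Fin C.card => (i : ℕ) < m).image
        fun i => (e i : ℕ+)
      have hT : T.card = m :=
        (Finset.card_image_of_injective _ (Subtype.val_injective.comp e.injective)).trans
          (by rw [Fin.card_filter_val_lt, min_eq_right hm])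
      have h1 := hdom T
      rw [hT] at h1
      calc (Finset.univ.filter fun v => rank v < m).card
          ≤ (Finset.univ.filter fun v => ψ v ∈ T).card := by
            refine Finset.card_le_card fun v hv => ?_
            rw [Finset.mem_filter] at hv ⊢
            refine ⟨hv.1, Finset.mem_image.2 ⟨e.symm ⟨ψ v, hψC v⟩, ?_, by simp⟩⟩
            exact Finset.mem_filter.2 ⟨Finset.mem_univ _, hv.2⟩
        _ ≤ _ := h1
        _ ≤ _ := by
            refine Finset.card_le_card fun v hv => ?_
            rw [Finset.mem_filter] at hv ⊢
            refine ⟨hv.1, ?_⟩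
            have := hpos v
            have := hv.2
            omega)
  refine hcross.trans ?_
  rw [coloringEntropy_eq ψ, div_add_one hN.ne']
  refine div_le_div_of_nonneg_right ?_ hN.le
  have h1 : ∀ v, Real.logb 2 (b ((φ v : ℕ) / 2 - 1) / 2) = Real.logb 2 (b (lev v - 1)) - 1 := by
    intro v
    rw [hφ, Real.logb_div (hbpos _ (hlev v)).ne' (by norm_num), Real.logb_self_eq_one (by norm_num)]
  rw [Finset.sum_congr rfl fun v _ => h1 v, Finset.sum_sub_distrib, Finset.sum_const, nsmul_eq_mul,
    Finset.card_univ, mul_one]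
  simp only [Finset.sum_neg_distrib, hbrank] at hle
  linarith

end Entropy

namespace RAM

/-- The row-major index of the entry `(a, b)` of a matrix with `n` columns. The variable `0` is
reserved for the sum that computes `n * a`. -/
def Tm.idx (a b : Tm) : Tm := .add (.sum 0 a) b

/-- `a ≤ b` -/
def Tm.le (a b : Tm) : Tm := .ite (.sub a b) (.lit 0) (.lit 1)

/-- `¬ a` -/
def Tm.neg (a : Tm) : Tm := .ite a (.lit 0) (.lit 1)

/-- `a ∧ b` -/
def Tm.and (a b : Tm) : Tm := .ite a b (.lit 0)

/-- `a ∨ b` -/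
def Tm.or (a b : Tm) : Tm := .ite a (.lit 1) b

/-- `a < b` -/
def Tm.lt (a b : Tm) : Tm := .neg (.le b a)

/-- `a = b` -/
def Tm.eq (a b : Tm) : Tm := .and (.le a b) (.le b a)

/-- the number of `x < n` with `a` -/
def Tm.count (x : ℕ) (a : Tm) : Tm := .sum x (.ite a (.lit 1) (.lit 0))

/-- The condition expressed by `a` holds if its value is not zero. -/
def Tm.Holds (n : ℕ) (m : ℕ → ℕ → ℕ) (ρ : ℕ → ℕ) (a : Tm) : Prop := a.val n m ρ ≠ 0

section Holds

variable {n : ℕ} {m : ℕ → ℕ → ℕ} {ρ : ℕ → ℕ} {a b : Tm} {x A : ℕ}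

theorem Tm.holds_le : (Tm.le a b).Holds n m ρ ↔ a.val n m ρ ≤ b.val n m ρ := by
  simp [Tm.Holds, Tm.le, Tm.val, Nat.sub_eq_zero_iff_le]

theorem Tm.holds_neg : (Tm.neg a).Holds n m ρ ↔ ¬ a.Holds n m ρ := by
  simp [Tm.Holds, Tm.neg, Tm.val]

theorem Tm.holds_and : (Tm.and a b).Holds n m ρ ↔ a.Holds n m ρ ∧ b.Holds n m ρ := by
  simp [Tm.Holds, Tm.and, Tm.val]

theorem Tm.holds_or : (Tm.or a b).Holds n m ρ ↔ a.Holds n m ρ ∨ b.Holds n m ρ := by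
  by_cases h : a.val n m ρ = 0 <;> simp [Tm.Holds, Tm.or, Tm.val, h]

theorem Tm.holds_lt : (Tm.lt a b).Holds n m ρ ↔ a.val n m ρ < b.val n m ρ := by
  simp [Tm.lt, Tm.holds_neg, Tm.holds_le]

theorem Tm.holds_eq : (Tm.eq a b).Holds n m ρ ↔ a.val n m ρ = b.val n m ρ := by
  simp [Tm.eq, Tm.holds_and, Tm.holds_le, le_antisymm_iff]

theorem Tm.holds_load : (Tm.load A a).Holds n m ρ ↔ m A (a.val n m ρ) ≠ 0 := Iff.rfl

theorem Tm.holds_sum :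
    (Tm.sum x a).Holds n m ρ ↔ ∃ i < n, a.Holds n m (Function.update ρ x i) := by
  simp [Tm.Holds, Tm.val]

open Classical in
theorem Tm.val_count : (Tm.count x a).val n m ρ =
    ((Finset.range n).filter fun i => a.Holds n m (Function.update ρ x i)).card := by
  rw [Finset.card_filter, Tm.count, Tm.val]
  refine Finset.sum_congr rfl fun i _ => ?_
  rw [Tm.val]
  congr 1

end Holds

theorem idx_inj {n u v u' v' : ℕ} (hv : v < n) (hv' : v' < n)
    (h : n * u + v = n * u' + v') : u = u' ∧ v = v' := by
  have h1 : (n * u + v) / n = u := by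
    rw [Nat.mul_add_div (by omega), Nat.div_eq_of_lt hv, add_zero]
  have h2 : (n * u' + v') / n = u' := by
    rw [Nat.mul_add_div (by omega), Nat.div_eq_of_lt hv', add_zero]
  have h3 : u = u' := by rw [← h1, ← h2, h]
  subst h3
  exact ⟨rfl, by omega⟩

/-! ### Computing the orientation -/

/-- the relation of being distinct and not adjacent, for the adjacency matrix in the array `0` -/
def nonadjTm (a b : Tm) : Tm := .neg (.or (.eq a b) (.load 0 (.idx a b)))

/-- One sweep adds to the relation in the array `2` all that its pairs force directly. -/
def sweepCmd : Cmd :=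
  .loop 5 (.loop 6 (.put 2 (.idx (.var 5) (.var 6))
    (.or (.load 2 (.idx (.var 5) (.var 6)))
      (.and (nonadjTm (.var 5) (.var 6))
        (.sum 7 (.or
          (.and (.load 2 (.idx (.var 5) (.var 7))) (.neg (nonadjTm (.var 7) (.var 6))))
          (.and (.load 2 (.idx (.var 7) (.var 6))) (.neg (nonadjTm (.var 5) (.var 7))))))))))

/-- Orients the pair `(1, 2)` of variables, if it has no direction yet, and all the pairs that are
forced by it. -/
def roundCmd : Cmd :=
  .seq (.put 2 (.idx (.var 1) (.var 2))
      (.or (.load 2 (.idx (.var 1) (.var 2)))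
        (.and (nonadjTm (.var 1) (.var 2)) (.neg (.load 2 (.idx (.var 2) (.var 1)))))))
    (.loop 3 (.loop 4 sweepCmd))

/-- Computes the orientation of the pairs of distinct nonadjacent vertices in the array `2`. -/
def orientCmd : Cmd := .loop 1 (.loop 2 roundCmd)

/-- The relation on the numbers below `n` whose matrix is the array `A`. -/
def relOf (n : ℕ) (m : ℕ → ℕ → ℕ) (A u v : ℕ) : Prop := u < n ∧ v < n ∧ m A (n * u + v) ≠ 0

/-- The relation of being distinct and not adjacent, for the adjacency matrix in the array `0`. -/
def nonadj (n : ℕ) (m : ℕ → ℕ → ℕ) (u v : ℕ) : Prop :=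
  u < n ∧ v < n ∧ u ≠ v ∧ ¬ relOf n m 0 u v

theorem relOf_put {n : ℕ} {m : ℕ → ℕ → ℕ} {A u v c : ℕ} (hu : u < n) (hv : v < n) {p q : ℕ} :
    relOf n (Function.update m A (Function.update (m A) (n * u + v) c)) A p q ↔
      if p = u ∧ q = v then c ≠ 0 else relOf n m A p q := by
  split_ifs with h
  · simp [relOf, h, hu, hv]
  · simp only [relOf, Function.update_self]
    refine and_congr_right fun _ => and_congr_right fun hq => ?_
    rw [Function.update_of_ne fun h' => h (idx_inj hq hv h')]

theorem nonadj_congr {n : ℕ} {m m' : ℕ → ℕ → ℕ} (h : m' 0 = m 0) : nonadj n m' = nonadj n m := by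
  unfold nonadj relOf
  rw [h]

theorem holds_nonadjTm {n : ℕ} {m : ℕ → ℕ → ℕ} {ρ : ℕ → ℕ} {x y : ℕ} (hx : x ≠ 0)
    (hxn : ρ x < n) (hyn : ρ y < n) :
    (nonadjTm (.var x) (.var y)).Holds n m ρ ↔ nonadj n m (ρ x) (ρ y) := by
  simp [nonadjTm, nonadj, relOf, Tm.holds_neg, Tm.holds_or, Tm.holds_eq, Tm.holds_load, Tm.idx,
    Tm.val, hx, hxn, hyn]

/-- What is known after the sweep has dealt with the pairs before `(u, w)`. -/
structure SweepInv (n : ℕ) (m : ℕ → ℕ → ℕ) (u w : ℕ) (m' : ℕ → ℕ → ℕ) : Prop where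
  frame : ∀ B, B ≠ 2 → m' B = m B
  rel : ∀ p q, relOf n m' 2 p q → nonadj n m p q
  mono : ∀ p q, relOf n m 2 p q → relOf n m' 2 p q
  sound : ∀ e : ℕ × ℕ, relOf n m' 2 e.1 e.2 →
    ∃ e₀ : ℕ × ℕ, relOf n m 2 e₀.1 e₀.2 ∧ ForcesStar (nonadj n m) e₀ e
  complete : ∀ e e' : ℕ × ℕ, relOf n m 2 e.1 e.2 → Forces (nonadj n m) e e' →
    (e'.1 < u ∨ e'.1 = u ∧ e'.2 < w) → relOf n m' 2 e'.1 e'.2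

theorem nonadj_symm {n : ℕ} {m : ℕ → ℕ → ℕ} (hs : ∀ u v, relOf n m 0 u v → relOf n m 0 v u)
    (u v : ℕ) (h : nonadj n m u v) : nonadj n m v u :=
  ⟨h.2.1, h.1, h.2.2.1.symm, fun h' => h.2.2.2 (hs _ _ h')⟩

theorem sweepCmd_inv {n : ℕ} {m : ℕ → ℕ → ℕ} (ρ : ℕ → ℕ)
    (hs : ∀ u v, relOf n m 0 u v → relOf n m 0 v u)
    (hrel : ∀ p q, relOf n m 2 p q → nonadj n m p q) :
    SweepInv n m n 0 (sweepCmd.run n ρ m) := by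
  refine upto_induct (fun u m' => SweepInv n m u 0 m') ?_ ?_
  · exact ⟨fun _ _ => rfl, hrel, fun _ _ h => h, fun e h => ⟨e, h, .refl⟩,
      fun e e' _ _ h => by omega⟩
  intro u m₁ hu h₁
  have h₂ := upto_induct (fun w m' => SweepInv n m u w m')
    (f := fun w m' => (Cmd.put 2 (.idx (.var 5) (.var 6))
    (.or (.load 2 (.idx (.var 5) (.var 6)))
      (.and (nonadjTm (.var 5) (.var 6))
        (.sum 7 (.or
          (.and (.load 2 (.idx (.var 5) (.var 7))) (.neg (nonadjTm (.var 7) (.var 6))))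
          (.and (.load 2 (.idx (.var 7) (.var 6))) (.neg (nonadjTm (.var 5) (.var 7))))))))).run n
      (Function.update (Function.update ρ 5 u) 6 w) m') (n := n) h₁ ?_
  · refine ⟨h₂.frame, h₂.rel, h₂.mono, h₂.sound, fun e e' he hf hlt => h₂.complete e e' he hf ?_⟩
    have := hf.2.1.2.1
    omega
  intro w m' hw h
  have hN : nonadj n m' = nonadj n m := nonadj_congr (h.frame 0 (by omega))
  have hsym := nonadj_symm hs
  have hput : ∀ p q, relOf n ((Cmd.put 2 (.idx (.var 5) (.var 6))
      (.or (.load 2 (.idx (.var 5) (.var 6)))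
      (.and (nonadjTm (.var 5) (.var 6))
        (.sum 7 (.or
          (.and (.load 2 (.idx (.var 5) (.var 7))) (.neg (nonadjTm (.var 7) (.var 6))))
          (.and (.load 2 (.idx (.var 7) (.var 6))) (.neg (nonadjTm (.var 5) (.var 7))))))))).run n
        (Function.update (Function.update ρ 5 u) 6 w) m') 2 p q ↔ relOf n m' 2 p q ∨
      (p = u ∧ q = w ∧ nonadj n m u w ∧ ∃ v < n, (relOf n m' 2 u v ∧ ¬ nonadj n m v w) ∨
        (relOf n m' 2 v w ∧ ¬ nonadj n m u v)) := by
    intro p q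
    have hidx : (Tm.idx (.var 5) (.var 6)).val n m' (Function.update (Function.update ρ 5 u) 6 w) =
        n * u + w := by simp [Tm.idx, Tm.val]
    rw [Cmd.run, hidx, relOf_put hu hw]
    split_ifs with hpq
    · obtain ⟨rfl, rfl⟩ := hpq
      change Tm.Holds _ _ _ _ ↔ _
      rw [Tm.holds_or, Tm.holds_and, holds_nonadjTm (by omega) (by simpa) (by simpa),
        Tm.holds_load, hidx, Tm.holds_sum]
      simp only [true_and]
      refine or_congr ⟨fun h => ⟨hu, hw, h⟩, fun h => h.2.2⟩ (and_congr (by simp [hN]) ?_)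
      refine exists_congr fun v => and_congr_right fun hv => ?_
      rw [Tm.holds_or, Tm.holds_and, Tm.holds_and, Tm.holds_neg, Tm.holds_neg,
        holds_nonadjTm (by omega) (by simpa) (by simpa),
        holds_nonadjTm (by omega) (by simpa) (by simpa)]
      simp [Tm.holds_load, Tm.idx, Tm.val, hN, relOf, hu, hw, hv]
    · have : ¬ (p = u ∧ q = w ∧ nonadj n m u w ∧ ∃ v < n, (relOf n m' 2 u v ∧ ¬ nonadj n m v w) ∨
        (relOf n m' 2 v w ∧ ¬ nonadj n m u v)) := fun h => hpq ⟨h.1, h.2.1⟩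
      simp only [this, or_false]
  refine ⟨fun B hB => ?_, fun p q hpq => ?_, fun p q hpq => (hput _ _).2 (.inl (h.mono _ _ hpq)),
    fun e he => ?_, fun e e' he hf hlt => (hput _ _).2 ?_⟩
  · rw [Cmd.run, Function.update_of_ne hB, h.frame B hB]
  · rcases (hput _ _).1 hpq with h' | ⟨rfl, rfl, h', -⟩
    · exact h.rel _ _ h'
    · exact h'
  · obtain ⟨p, q⟩ := e
    rcases (hput _ _).1 he with h' | ⟨rfl, rfl, h', v, -, ⟨h1, h2⟩ | ⟨h1, h2⟩⟩
    · exact h.sound _ h'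
    · obtain ⟨e₀, h3, h4⟩ := h.sound (p, v) h1
      exact ⟨e₀, h3, h4.tail ⟨h.rel _ _ h1, h', .inl ⟨rfl, h2⟩⟩⟩
    · obtain ⟨e₀, h3, h4⟩ := h.sound (v, q) h1
      exact ⟨e₀, h3, h4.tail ⟨h.rel _ _ h1, h', .inr ⟨rfl, fun h5 => h2 (hsym _ _ h5)⟩⟩⟩
  · by_cases hlt' : e'.1 < u ∨ e'.1 = u ∧ e'.2 < w
    · exact .inl (h.complete e e' he hf hlt')
    · have h1 : e'.1 = u := by omega
      have h2 : e'.2 = w := by omega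
      have h3 := h.mono _ _ he
      refine .inr ⟨h1, h2, h1 ▸ h2 ▸ hf.2.1, ?_⟩
      rcases hf.2.2 with ⟨h4, h5⟩ | ⟨h4, h5⟩
      · exact ⟨e.2, he.2.1, .inl ⟨by rwa [← h1, ← h4], by rwa [← h2]⟩⟩
      · exact ⟨e.1, he.1, .inr ⟨by rwa [← h2, ← h4],
          fun h6 => h5 (hsym _ _ (by rwa [h1]))⟩⟩

open Classical in
/-- `n * n` sweeps reach a relation that is closed under `Forces`: each sweep that starts from a
relation that is not closed adds at least one of the `n * n` pairs. -/
theorem sweeps_closed {n : ℕ} {m : ℕ → ℕ → ℕ} (ρ : ℕ → ℕ)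
    (hs : ∀ u v, relOf n m 0 u v → relOf n m 0 v u)
    (hrel : ∀ p q, relOf n m 2 p q → nonadj n m p q) :
    ∃ m', m' = (Cmd.loop 3 (.loop 4 sweepCmd)).run n ρ m ∧ (∀ B, B ≠ 2 → m' B = m B) ∧
      (∀ p q, relOf n m 2 p q → relOf n m' 2 p q) ∧
      (∀ e : ℕ × ℕ, relOf n m' 2 e.1 e.2 →
        ∃ e₀ : ℕ × ℕ, relOf n m 2 e₀.1 e₀.2 ∧ ForcesStar (nonadj n m) e₀ e) ∧
      ∀ e e' : ℕ × ℕ, relOf n m' 2 e.1 e.2 → Forces (nonadj n m) e e' →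
        relOf n m' 2 e'.1 e'.2 := by
  set cl : (ℕ → ℕ → ℕ) → Prop := fun m' => ∀ e e' : ℕ × ℕ, relOf n m' 2 e.1 e.2 →
    Forces (nonadj n m) e e' → relOf n m' 2 e'.1 e'.2
  set pairs : (ℕ → ℕ → ℕ) → Finset (ℕ × ℕ) := fun m' =>
    (Finset.range n ×ˢ Finset.range n).filter fun e => relOf n m' 2 e.1 e.2 with hpairs
  have hmem : ∀ m' e, e ∈ pairs m' ↔ relOf n m' 2 e.1 e.2 := by
    intro m' e
    simp only [hpairs, Finset.mem_filter, Finset.mem_product, Finset.mem_range]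
    exact ⟨fun h => h.2, fun h => ⟨⟨h.1, h.2.1⟩, h⟩⟩
  set I : ℕ → (ℕ → ℕ → ℕ) → Prop := fun c m' => (∀ B, B ≠ 2 → m' B = m B) ∧
    (∀ p q, relOf n m 2 p q → relOf n m' 2 p q) ∧
    (∀ e : ℕ × ℕ, relOf n m' 2 e.1 e.2 →
      ∃ e₀ : ℕ × ℕ, relOf n m 2 e₀.1 e₀.2 ∧ ForcesStar (nonadj n m) e₀ e) ∧
    (cl m' ∨ c ≤ (pairs m').card)
  have step : ∀ c m' ρ, I c m' → I (c + 1) (sweepCmd.run n ρ m') := by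
    rintro c m' ρ ⟨h1, h2, h3, h4⟩
    have h0 : m' 0 = m 0 := h1 0 (by omega)
    have hN : nonadj n m' = nonadj n m := nonadj_congr h0
    have hinv := sweepCmd_inv (m := m') ρ (by unfold relOf at hs ⊢; rwa [h0]) (by
      intro p q hpq
      obtain ⟨e₀, he₀, hst⟩ := h3 (p, q) hpq
      rw [hN]
      exact hst.mem (P := fun e => nonadj n m e.1 e.2) (fun _ _ _ h => h.2.1) (hrel _ _ he₀))
    refine ⟨fun B hB => (hinv.frame B hB).trans (h1 B hB), fun p q h => hinv.mono _ _ (h2 _ _ h),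
      fun e he => ?_, ?_⟩
    · obtain ⟨e₁, he₁, hst⟩ := hinv.sound e he
      obtain ⟨e₀, he₀, hst'⟩ := h3 e₁ he₁
      exact ⟨e₀, he₀, hst'.trans (hN ▸ hst)⟩
    · by_cases hcl : cl m'
      · left
        intro e e' he hf
        obtain ⟨e₁, he₁, hst⟩ := hinv.sound e he
        rw [hN] at hst
        exact hinv.mono _ _ (hcl _ _ (hst.mem (P := fun e => relOf n m' 2 e.1 e.2) hcl he₁) hf)
      · right
        have h5 := h4.resolve_left hcl
        simp only [cl] at hcl
        push Not at hcl
        obtain ⟨e, e', he, hf, he'⟩ := hcl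
        have h6 : (pairs m').card < (pairs (sweepCmd.run n ρ m')).card := by
          refine Finset.card_lt_card (Finset.ssubset_iff_of_subset (fun e he => ?_) |>.2
            ⟨e', ?_, ?_⟩)
          · rw [hmem] at he ⊢
            exact hinv.mono _ _ he
          · rw [hmem]
            exact hinv.complete e e' he (hN ▸ hf) (.inl hf.2.1.1)
          · rwa [hmem]
        omega
  have hfin : I (n * n) ((Cmd.loop 3 (.loop 4 sweepCmd)).run n ρ m) := by
    refine upto_induct (fun i => I (i * n)) ?_ fun i m' _ hi => ?_
    · exact ⟨fun _ _ => rfl, fun _ _ h => h, fun e h => ⟨e, h, .refl⟩, .inr (by simp)⟩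
    · have := upto_induct (fun j => I (i * n + j))
        (f := fun j m' => sweepCmd.run n (Function.update (Function.update ρ 3 i) 4 j) m')
        (n := n) hi fun j m' _ h => step _ _ _ h
      rw [Nat.succ_mul]
      exact this
  obtain ⟨h1, h2, h3, h4⟩ := hfin
  refine ⟨_, rfl, h1, h2, h3, h4.elim id fun hcard => ?_⟩
  intro e e' _ hf
  have : pairs ((Cmd.loop 3 (.loop 4 sweepCmd)).run n ρ m) = Finset.range n ×ˢ Finset.range n :=
    Finset.eq_of_subset_of_card_le (Finset.filter_subset _ _) (by simpa using hcard)
  rw [← hmem, this, Finset.mem_product, Finset.mem_range, Finset.mem_range]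
  exact ⟨hf.2.1.1, hf.2.1.2.1⟩

/-- What is known after the pairs before `(a, b)` have been oriented. -/
structure OrientInv (n : ℕ) (m : ℕ → ℕ → ℕ) (a b : ℕ) (m' : ℕ → ℕ → ℕ) : Prop where
  frame : ∀ B, B ≠ 2 → m' B = m B
  orientation : IsPartialOrientation (nonadj n m) (relOf n m' 2)
  done : ∀ p q, p < a ∨ p = a ∧ q < b → nonadj n m p q → relOf n m' 2 p q ∨ relOf n m' 2 q p

theorem roundCmd_inv {n : ℕ} {m : ℕ → ℕ → ℕ} (ρ : ℕ → ℕ)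
    (hs : ∀ u v, relOf n m 0 u v → relOf n m 0 v u)
    {F : ℕ → ℕ → Prop} (hF : ∀ u v, F u v → ¬ F v u) (hFN : ∀ u v, nonadj n m u v → F u v ∨ F v u)
    (hFc : ∀ e e' : ℕ × ℕ, F e.1 e.2 → Forces (nonadj n m) e e' → F e'.1 e'.2)
    {a b : ℕ} (ha : a < n) (hb : b < n) {m' : ℕ → ℕ → ℕ} (h : OrientInv n m a b m') :
    OrientInv n m a (b + 1) (roundCmd.run n (Function.update (Function.update ρ 1 a) 2 b) m') := by
  have hN : nonadj n m' = nonadj n m := nonadj_congr (h.frame 0 (by omega))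
  set ρ' := Function.update (Function.update ρ 1 a) 2 b with hρ'
  have hidx : (Tm.idx (.var 1) (.var 2)).val n m' ρ' = n * a + b := by
    simp [Tm.idx, Tm.val, hρ']
  set m₁ := (Cmd.put 2 (.idx (.var 1) (.var 2))
      (.or (.load 2 (.idx (.var 1) (.var 2)))
        (.and (nonadjTm (.var 1) (.var 2)) (.neg (.load 2 (.idx (.var 2) (.var 1))))))).run n ρ' m'
    with hm₁
  have hput : ∀ p q, relOf n m₁ 2 p q ↔ relOf n m' 2 p q ∨
      (p = a ∧ q = b ∧ nonadj n m a b ∧ ¬ relOf n m' 2 b a) := by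
    intro p q
    rw [hm₁, Cmd.run, hidx, relOf_put ha hb]
    split_ifs with hpq
    · obtain ⟨rfl, rfl⟩ := hpq
      change Tm.Holds _ _ _ _ ↔ _
      rw [Tm.holds_or, Tm.holds_and, holds_nonadjTm (by omega) (by simpa [hρ']) (by simpa [hρ']),
        Tm.holds_load, hidx, Tm.holds_neg, Tm.holds_load]
      simp [Tm.idx, Tm.val, hρ', relOf, ha, hb, hN]
    · have : ¬ (p = a ∧ q = b ∧ nonadj n m a b ∧ ¬ relOf n m' 2 b a) := fun h => hpq ⟨h.1, h.2.1⟩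
      simp only [this, or_false]
  have hframe : ∀ B, B ≠ 2 → m₁ B = m B := fun B hB => by
    rw [hm₁, Cmd.run, Function.update_of_ne hB, h.frame B hB]
  have h0 := hframe 0 (by omega)
  have hN₁ : nonadj n m₁ = nonadj n m := nonadj_congr h0
  obtain ⟨m₂, hm₂, f₂, mono, sound, closed⟩ := sweeps_closed (m := m₁) ρ'
    (by unfold relOf at hs ⊢; rwa [h0]) (by
      intro p q hpq
      rw [hN₁]
      rcases (hput _ _).1 hpq with h' | ⟨rfl, rfl, h', -⟩
      · exact h.orientation.rel _ _ h'
      · exact h')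
  rw [hN₁] at sound closed
  have hrun : roundCmd.run n ρ' m' = m₂ := hm₂.symm
  rw [hrun]
  have hframe₂ : ∀ B, B ≠ 2 → m₂ B = m B := fun B hB => (f₂ B hB).trans (hframe B hB)
  have hmono : ∀ p q, relOf n m' 2 p q → relOf n m₂ 2 p q := fun p q hpq =>
    mono _ _ ((hput _ _).2 (.inl hpq))
  have hold : ∀ p q, p < a ∨ p = a ∧ q < b → nonadj n m p q →
      relOf n m₂ 2 p q ∨ relOf n m₂ 2 q p := fun p q hlt hpq =>
    (h.done p q hlt hpq).imp (hmono _ _) (hmono _ _)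
  by_cases hnew : nonadj n m a b ∧ ¬ relOf n m' 2 b a
  · have heq : relOf n m₂ 2 = fun p q =>
        relOf n m' 2 p q ∨ ForcesStar (nonadj n m) (a, b) (p, q) := by
      funext p q
      refine propext ⟨fun hpq => ?_, fun hpq => ?_⟩
      · obtain ⟨⟨p₀, q₀⟩, he₀, hst⟩ := sound (p, q) hpq
        rcases (hput _ _).1 he₀ with h' | ⟨h1, h2, -⟩
        · exact .inl (hst.mem (P := fun e => relOf n m' 2 e.1 e.2) h.orientation.closed h')
        · obtain rfl : p₀ = a := h1
          obtain rfl : q₀ = b := h2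
          exact .inr hst
      · rcases hpq with h' | hst
        · exact hmono _ _ h'
        · exact hst.mem (P := fun e => relOf n m₂ 2 e.1 e.2) closed
            (mono _ _ ((hput _ _).2 (.inr ⟨rfl, rfl, hnew⟩)))
    refine ⟨hframe₂, ?_, fun p q hlt hpq => ?_⟩
    · rw [heq]
      exact h.orientation.extend (nonadj_symm hs) hF hFN hFc hnew.1 hnew.2
        fun p q hp => h.done p q (.inl hp)
    · by_cases hlt' : p < a ∨ p = a ∧ q < b
      · exact hold p q hlt' hpq
      · obtain rfl : p = a := by omega
        obtain rfl : q = b := by omega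
        rw [heq]
        exact .inl (.inr .refl)
  · have heq : relOf n m₂ 2 = relOf n m' 2 := by
      funext p q
      refine propext ⟨fun hpq => ?_, hmono p q⟩
      obtain ⟨⟨p₀, q₀⟩, he₀, hst⟩ := sound (p, q) hpq
      rcases (hput _ _).1 he₀ with h' | ⟨-, -, h'⟩
      · exact hst.mem (P := fun e => relOf n m' 2 e.1 e.2) h.orientation.closed h'
      · exact absurd h' hnew
    refine ⟨hframe₂, heq ▸ h.orientation, fun p q hlt hpq => ?_⟩
    by_cases hlt' : p < a ∨ p = a ∧ q < b
    · exact hold p q hlt' hpq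
    · obtain rfl : p = a := by omega
      obtain rfl : q = b := by omega
      rw [heq]
      exact .inr (by_contra fun h' => hnew ⟨hpq, h'⟩)

theorem orientCmd_inv {n : ℕ} {m : ℕ → ℕ → ℕ} (ρ : ℕ → ℕ)
    (hs : ∀ u v, relOf n m 0 u v → relOf n m 0 v u) (h2 : ∀ i, m 2 i = 0)
    {F : ℕ → ℕ → Prop} (hF : ∀ u v, F u v → ¬ F v u) (hFN : ∀ u v, nonadj n m u v → F u v ∨ F v u)
    (hFc : ∀ e e' : ℕ × ℕ, F e.1 e.2 → Forces (nonadj n m) e e' → F e'.1 e'.2) :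
    OrientInv n m n 0 (orientCmd.run n ρ m) := by
  have hempty : ∀ p q, ¬ relOf n m 2 p q := fun p q h => h.2.2 (h2 _)
  refine upto_induct (fun a m' => OrientInv n m a 0 m') ?_ ?_
  · exact ⟨fun _ _ => rfl, ⟨fun p q h => absurd h (hempty p q), fun p q h => absurd h (hempty p q),
      fun e _ h => absurd h (hempty _ _), fun p q h => absurd h (hempty p q)⟩,
      fun p q h => by omega⟩
  intro a m' ha h
  have := upto_induct (fun b m' => OrientInv n m a b m')
    (f := fun b m' => roundCmd.run n (Function.update (Function.update ρ 1 a) 2 b) m') (n := n) h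
    fun b m'' hb h => roundCmd_inv ρ hs hF hFN hFc ha hb h
  exact ⟨this.frame, this.orientation, fun p q hlt hpq =>
    this.done p q (by have := hpq.2.1; omega) hpq⟩

end RAM

namespace RAM

/-! ### Sorting and coloring -/

/-- the number of pairs of the relation in the array `2` that start with a given vertex -/
def countCmd : Cmd := .loop 1 (.put 3 (.var 1) (.count 2 (.load 2 (.idx (.var 1) (.var 2)))))

/-- the order by decreasing entries of the array `3`, with ties broken by the vertex numbers -/
def beforeTm (a b : Tm) : Tm :=
  .or (.lt (.load 3 b) (.load 3 a)) (.and (.eq (.load 3 b) (.load 3 a)) (.lt a b))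

/-- Lists the vertices in the array `4`, sorted by `beforeTm`. -/
def sortCmd : Cmd := .loop 1 (.put 4 (.count 2 (beforeTm (.var 2) (.var 1))) (.var 1))

/-- The interval at the position `b` contains the right endpoint of the one at the position
`a`. -/
def coversTm (a b : Tm) : Tm :=
  .and (.le a b) (.or (.eq a b) (.load 0 (.idx (.load 4 a) (.load 4 b))))

/-- Runs the greedy algorithm for all capacities below `n`; row `k` of the array `5` marks the
positions that are accepted for `k`. -/
def greedyCmd : Cmd :=
  .loop 1 (.loop 2 (.put 5 (.idx (.var 2) (.var 1))
    (.neg (.sum 3 (.and (coversTm (.var 3) (.var 1)) (.le (.var 2)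
      (.count 4 (.and (.and (.lt (.var 4) (.var 1)) (coversTm (.var 3) (.var 4)))
        (.load 5 (.idx (.var 2) (.var 4)))))))))))

/-- Computes the levels of the positions in the array `6`. -/
def levelCmd : Cmd :=
  .loop 1 (.put 6 (.var 1) (.count 2 (.neg (.load 5 (.idx (.var 2) (.var 1))))))

/-- Counts in the array `7` the earlier positions of the same level. -/
def rankCmd : Cmd :=
  .loop 1 (.put 7 (.var 1)
    (.count 2 (.and (.lt (.var 2) (.var 1)) (.eq (.load 6 (.var 2)) (.load 6 (.var 1))))))

/-- Writes the colors: twice the level, plus the parity of the rank within the level. -/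
def colorCmd : Cmd :=
  .loop 1 (.put 1 (.load 4 (.var 1))
    (.add (.add (.load 6 (.var 1)) (.load 6 (.var 1)))
      (.count 2 (.eq (.add (.add (.var 2) (.var 2)) (.lit 1)) (.load 7 (.var 1))))))

/-- The whole coloring algorithm. -/
def coloringCmd : Cmd :=
  .seq orientCmd (.seq countCmd (.seq sortCmd (.seq greedyCmd
    (.seq levelCmd (.seq rankCmd colorCmd)))))

/-- A loop that fills an array with values that do not depend on this array. -/
theorem run_loop_put {n A x : ℕ} {a b : Tm} {ρ : ℕ → ℕ} {m : ℕ → ℕ → ℕ} (f g : ℕ → ℕ)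
    (hf : ∀ i j, i < n → j < n → f i = f j → i = j)
    (ha : ∀ i < n, ∀ m', (∀ B, B ≠ A → m' B = m B) → a.val n m' (Function.update ρ x i) = f i)
    (hb : ∀ i < n, ∀ m', (∀ B, B ≠ A → m' B = m B) → b.val n m' (Function.update ρ x i) = g i) :
    (∀ B, B ≠ A → (Cmd.loop x (.put A a b)).run n ρ m B = m B) ∧
      ∀ i < n, (Cmd.loop x (.put A a b)).run n ρ m A (f i) = g i := by
  have := upto_induct (a := m) (n := n)
    (f := fun i m' => (Cmd.put A a b).run n (Function.update ρ x i) m')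
    (fun k m' => k ≤ n → (∀ B, B ≠ A → m' B = m B) ∧ ∀ i < k, m' A (f i) = g i)
    (fun _ => ⟨fun _ _ => rfl, fun i hi => by omega⟩)
    (fun i m' hi h _ => by
      obtain ⟨h1, h2⟩ := h hi.le
      refine ⟨fun B hB => ?_, fun j hj => ?_⟩
      · rw [Cmd.run, Function.update_of_ne hB, h1 B hB]
      · rw [Cmd.run, Function.update_self, ha i hi m' h1, hb i hi m' h1]
        rcases Nat.lt_succ_iff_lt_or_eq.1 hj with hj | rfl
        · rw [Function.update_of_ne, h2 j hj]
          intro h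
          have := hf _ _ (hj.trans hi) hi h
          omega
        · rw [Function.update_self])
  exact this le_rfl

variable {n : ℕ} {m : ℕ → ℕ → ℕ} {ρ : ℕ → ℕ}

open Classical in
theorem countCmd_run : (∀ B, B ≠ 3 → countCmd.run n ρ m B = m B) ∧
    ∀ v < n, countCmd.run n ρ m 3 v =
      ((Finset.range n).filter fun w => relOf n m 2 v w).card := by
  refine run_loop_put (fun v => v) _ (fun _ _ _ _ h => h) (fun v _ m' _ => by simp [Tm.val])
    fun v hv m' h => ?_
  rw [Tm.val_count]
  congr 1
  refine Finset.filter_congr fun w hw => ?_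
  rw [Finset.mem_range] at hw
  simp [Tm.holds_load, Tm.idx, Tm.val, relOf, hv, hw, h]

/-- The order that `beforeTm` describes. -/
def before (m : ℕ → ℕ → ℕ) (u v : ℕ) : Prop := m 3 v < m 3 u ∨ m 3 v = m 3 u ∧ u < v

theorem before_trans (u v w : ℕ) (h : before m u v) (h' : before m v w) : before m u w := by
  unfold before at *
  omega

theorem before_irrefl (u : ℕ) : ¬ before m u u := by
  unfold before
  omega

theorem before_total (u v : ℕ) (h : u ≠ v) : before m u v ∨ before m v u := by
  unfold before
  omega

open Classical in
theorem sortCmd_run : (∀ B, B ≠ 4 → sortCmd.run n ρ m B = m B) ∧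
    ∀ v < n, sortCmd.run n ρ m 4 (position (before m) n v) = v := by
  refine run_loop_put (position (before m) n) (fun v => v) (fun u v hu hv h => ?_)
    (fun v _ m' h => ?_) (fun v _ m' _ => by simp [Tm.val])
  · exact position_injOn before_trans before_irrefl before_total (by simpa using hu)
      (by simpa using hv) h
  · rw [Tm.val_count, position]
    congr 1
    refine Finset.filter_congr fun u _ => ?_
    simp [beforeTm, before, Tm.holds_or, Tm.holds_and, Tm.holds_lt, Tm.holds_eq, Tm.val, h]

/-- The relation that `coversTm` describes, where the numbers from `n` on stand for isolated
points. -/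
def covers (n : ℕ) (m : ℕ → ℕ → ℕ) (u x : ℕ) : Prop :=
  u ≤ x ∧ (u = x ∨ x < n ∧ m 0 (n * m 4 u + m 4 x) ≠ 0)

theorem holds_coversTm {x y : ℕ} (hx : x ≠ 0) (hyn : ρ y < n) :
    (coversTm (.var x) (.var y)).Holds n m ρ ↔ covers n m (ρ x) (ρ y) := by
  simp [coversTm, covers, Tm.holds_and, Tm.holds_or, Tm.holds_le, Tm.holds_eq, Tm.holds_load,
    Tm.idx, Tm.val, hx, hyn]

theorem covers_congr {m' : ℕ → ℕ → ℕ} (h0 : m' 0 = m 0) (h4 : m' 4 = m 4) :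
    covers n m' = covers n m := by
  unfold covers
  rw [h0, h4]

open Classical in
theorem greedyCmd_run : (∀ B, B ≠ 5 → greedyCmd.run n ρ m B = m B) ∧
    ∀ i < n, ∀ k < n, greedyCmd.run n ρ m 5 (n * k + i) ≠ 0 ↔
      i ∈ chosen (covers n m) k (i + 1) := by
  set J : ℕ → ℕ → (ℕ → ℕ → ℕ) → Prop := fun i k m' => (∀ B, B ≠ 5 → m' B = m B) ∧
    ∀ j < n, ∀ c < n, j < i ∨ j = i ∧ c < k →
      (m' 5 (n * c + j) ≠ 0 ↔ j ∈ chosen (covers n m) c (j + 1)) with hJ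
  have key : J n 0 (greedyCmd.run n ρ m) := by
    refine upto_induct (fun i m' => J i 0 m') ⟨fun _ _ => rfl, fun j _ c _ h => by omega⟩ ?_
    intro i m₁ hi h₁
    have h₂ := upto_induct (fun k m' => J i k m') (a := m₁) (n := n)
      (f := fun k m' => (Cmd.put 5 (.idx (.var 2) (.var 1))
        (.neg (.sum 3 (.and (coversTm (.var 3) (.var 1)) (.le (.var 2)
          (.count 4 (.and (.and (.lt (.var 4) (.var 1)) (coversTm (.var 3) (.var 4)))
            (.load 5 (.idx (.var 2) (.var 4)))))))))).run n
        (Function.update (Function.update ρ 1 i) 2 k) m') h₁ ?_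
    · exact ⟨h₂.1, fun j hj c hc h => h₂.2 j hj c hc (by omega)⟩
    rintro k m' hk ⟨hframe, h⟩
    have hidx : (Tm.idx (.var 2) (.var 1)).val n m' (Function.update (Function.update ρ 1 i) 2 k) =
        n * k + i := by simp [Tm.idx, Tm.val]
    refine ⟨fun B hB => ?_, fun j hj c hc hlt => ?_⟩
    · rw [Cmd.run, Function.update_of_ne hB, hframe B hB]
    rw [Cmd.run, hidx, Function.update_self]
    by_cases hjc : j = i ∧ c = k
    · obtain ⟨rfl, rfl⟩ := hjc
      rw [Function.update_self, mem_chosen_succ]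
      change Tm.Holds _ _ _ _ ↔ _
      rw [Tm.holds_neg, Tm.holds_sum]
      push Not
      have hin : ∀ u < n, ((Tm.and (coversTm (.var 3) (.var 1)) (.le (.var 2)
          (.count 4 (.and (.and (.lt (.var 4) (.var 1)) (coversTm (.var 3) (.var 4)))
            (.load 5 (.idx (.var 2) (.var 4))))))).Holds n m'
          (Function.update (Function.update (Function.update ρ 1 j) 2 c) 3 u) ↔
          covers n m u j ∧ c ≤ ((chosen (covers n m) c j).filter (covers n m u)).card) := by
        intro u hu
        rw [Tm.holds_and, holds_coversTm (by omega) (by simpa), Tm.holds_le, Tm.val_count,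
          covers_congr (hframe 0 (by omega)) (hframe 4 (by omega))]
        refine and_congr (by simp) ?_
        have : (Finset.range n).filter (fun x => (Tm.and (.and (.lt (.var 4) (.var 1))
            (coversTm (.var 3) (.var 4))) (.load 5 (.idx (.var 2) (.var 4)))).Holds n m'
            (Function.update (Function.update (Function.update
              (Function.update ρ 1 j) 2 c) 3 u) 4 x)) =
            (chosen (covers n m) c j).filter (covers n m u) := by
          ext x
          rw [Finset.mem_filter, Finset.mem_filter, mem_chosen_iff, Finset.mem_range]
          constructor
          · rintro ⟨hx, hh⟩
            rw [Tm.holds_and, Tm.holds_and, holds_coversTm (by omega) (by simpa), Tm.holds_lt,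
              covers_congr (hframe 0 (by omega)) (hframe 4 (by omega))] at hh
            simp only [Tm.holds_load, Tm.idx, Tm.val, ne_eq,
              OfNat.ofNat_ne_zero, not_false_eq_true, Function.update_of_ne, Function.update_self,
              Nat.reduceEqDiff, OfNat.one_ne_ofNat, Finset.sum_const,
              Finset.card_range, smul_eq_mul] at hh
            exact ⟨⟨hh.1.1, (h x hx c hc (by omega)).1 hh.2⟩, hh.1.2⟩
          · rintro ⟨⟨hxj, hx⟩, hux⟩
            refine ⟨by omega, ?_⟩
            rw [Tm.holds_and, Tm.holds_and, holds_coversTm (by omega) (by simp; omega), Tm.holds_lt,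
              covers_congr (hframe 0 (by omega)) (hframe 4 (by omega))]
            simp only [Tm.holds_load, Tm.idx, Tm.val, ne_eq,
              OfNat.ofNat_ne_zero, not_false_eq_true, Function.update_of_ne, Function.update_self,
              Nat.reduceEqDiff, OfNat.one_ne_ofNat, Finset.sum_const,
              Finset.card_range, smul_eq_mul]
            exact ⟨⟨hxj, hux⟩, (h x (by omega) c hc (by omega)).2 hx⟩
        rw [this]
        simp [Tm.val]
      constructor
      · intro hh u hu
        have := hh u (hu.1.trans_lt hi)
        rw [hin u (hu.1.trans_lt hi)] at this
        exact not_le.1 fun h => this ⟨hu, h⟩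
      · intro hh u hu hu'
        rw [hin u hu] at hu'
        exact absurd (hh u hu'.1) (not_lt.2 hu'.2)
    · rw [Function.update_of_ne fun h' => hjc ((idx_inj hj hi h').symm), h j hj c hc (by omega)]
  exact ⟨key.1, fun i hi k hk => key.2 i hi k hk (.inl hi)⟩

open Classical in
theorem levelCmd_run {K : ℕ → ℕ → Prop} (hle : ∀ u x, K u x → u ≤ x)
    (hC : ∀ u v x, K u x → u ≤ v → v ≤ x → K v x)
    (h5 : ∀ i < n, ∀ k < n, m 5 (n * k + i) ≠ 0 ↔ i ∈ chosen K k (i + 1)) :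
    (∀ B, B ≠ 6 → levelCmd.run n ρ m B = m B) ∧
      ∀ i < n, levelCmd.run n ρ m 6 i = level K i := by
  refine run_loop_put (fun v => v) _ (fun _ _ _ _ h => h) (fun v _ m' _ => by simp [Tm.val])
    fun i hi m' h => ?_
  rw [Tm.val_count]
  have : (Finset.range n).filter (fun k => (Tm.neg (.load 5 (.idx (.var 2) (.var 1)))).Holds n m'
      (Function.update (Function.update ρ 1 i) 2 k)) = Finset.range (level K i) := by
    ext k
    have hl := level_le (K := K) i
    rw [Finset.mem_filter, Finset.mem_range, Finset.mem_range]
    have : k < n → ((Tm.neg (.load 5 (.idx (.var 2) (.var 1)))).Holds n m'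
        (Function.update (Function.update ρ 1 i) 2 k) ↔ k < level K i) := by
      intro hk
      have h5' := h5 i hi k hk
      rw [mem_chosen_iff_level hle hC] at h5'
      rw [Tm.holds_neg, Tm.holds_load, h 5 (by omega)]
      simp only [Tm.idx, Tm.val, ne_eq, OfNat.ofNat_ne_zero,
        not_false_eq_true, Function.update_of_ne, Function.update_self,
        OfNat.one_ne_ofNat, Finset.sum_const, Finset.card_range, smul_eq_mul]
      rw [← ne_eq, h5']
      omega
    constructor
    · rintro ⟨h1, h2⟩
      exact (this h1).1 h2
    · intro h1
      have hk : k < n := by omega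
      exact ⟨hk, (this hk).2 h1⟩
  rw [this, Finset.card_range]

theorem rankCmd_run : (∀ B, B ≠ 7 → rankCmd.run n ρ m B = m B) ∧
    ∀ i < n, rankCmd.run n ρ m 7 i =
      ((Finset.range i).filter fun x => m 6 x = m 6 i).card := by
  refine run_loop_put (fun v => v) _ (fun _ _ _ _ h => h) (fun v _ m' _ => by simp [Tm.val])
    fun i hi m' h => ?_
  rw [Tm.val_count]
  congr 1
  ext x
  simp only [Finset.mem_filter, Finset.mem_range, Tm.holds_and, Tm.holds_lt, Tm.holds_eq, Tm.val,
    h 6 (by omega), Function.update_self, ne_eq, OfNat.one_ne_ofNat, not_false_eq_true,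
    Function.update_of_ne]
  exact ⟨fun h => h.2, fun h => ⟨h.1.trans hi, h⟩⟩

theorem colorCmd_run (h4 : ∀ i j, i < n → j < n → m 4 i = m 4 j → i = j)
    (h7 : ∀ i < n, m 7 i ≤ i) :
    ∀ i < n, colorCmd.run n ρ m 1 (m 4 i) = 2 * m 6 i + m 7 i % 2 := by
  refine (run_loop_put (m 4) _ h4 (fun i _ m' h => by simp [Tm.val, h])
    fun i hi m' h => ?_).2
  rw [Tm.val, Tm.val_count, Tm.val]
  simp only [Tm.holds_eq, Tm.val, h 6 (by omega), h 7 (by omega), Function.update_self, ne_eq,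
    OfNat.one_ne_ofNat, not_false_eq_true, Function.update_of_ne]
  have : ((Finset.range n).filter fun j => j + j + 1 = m 7 i).card = m 7 i % 2 := by
    have hi7 := h7 i hi
    rcases Nat.mod_two_eq_zero_or_one (m 7 i) with h | h
    · rw [h, Finset.card_eq_zero, Finset.filter_eq_empty_iff]
      intro j _
      omega
    · rw [h, Finset.card_eq_one]
      refine ⟨m 7 i / 2, ?_⟩
      ext j
      rw [Finset.mem_filter, Finset.mem_range, Finset.mem_singleton]
      omega
  rw [← this]
  congr 1
  omega

end RAM

namespace RAM

/-! ### Correctness of the coloring algorithm -/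

/-- The array `0` is the adjacency matrix of an interval graph on the numbers below `n`. -/
def IntervalMatrix (n : ℕ) (m : ℕ → ℕ → ℕ) : Prop :=
  ∃ l r : ℕ → ℝ, (∀ u, l u ≤ r u) ∧
    ∀ u v, relOf n m 0 u v ↔ u < n ∧ v < n ∧ u ≠ v ∧ l u ≤ r v ∧ l v ≤ r u

theorem relOf_graphInput {n : ℕ} (G : SimpleGraph (Fin n)) (u v : ℕ) :
    relOf n (graphInput G).arr 0 u v ↔ ∃ (hu : u < n) (hv : v < n), G.Adj ⟨u, hu⟩ ⟨v, hv⟩ := by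
  constructor
  · rintro ⟨hu, hv, h⟩
    simp only [graphInput, true_and, ne_eq, ite_eq_right_iff, one_ne_zero, imp_false,
      not_not] at h
    obtain ⟨i, j, hij, hadj⟩ := h
    rw [Nat.mul_comm (i : ℕ)] at hij
    obtain ⟨h1, h2⟩ := idx_inj hv j.2 hij
    refine ⟨hu, hv, ?_⟩
    convert hadj
  · rintro ⟨hu, hv, h⟩
    refine ⟨hu, hv, ?_⟩
    simp only [graphInput, true_and, ne_eq, ite_eq_right_iff, one_ne_zero, imp_false, not_not]
    exact ⟨⟨u, hu⟩, ⟨v, hv⟩, by simp [Nat.mul_comm], h⟩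

theorem intervalMatrix_graphInput {n : ℕ} {G : SimpleGraph (Fin n)} (hG : IsIntervalGraph G) :
    IntervalMatrix n (graphInput G).arr := by
  obtain ⟨l, r, hlr, hadj⟩ := hG
  refine ⟨fun u => if h : u < n then l ⟨u, h⟩ else 0, fun u => if h : u < n then r ⟨u, h⟩ else 0,
    fun u => ?_, fun u v => ?_⟩
  · dsimp only
    split_ifs
    · exact hlr _
    · exact le_rfl
  · rw [relOf_graphInput]
    constructor
    · rintro ⟨hu, hv, h⟩
      rw [hadj, Set.Icc_inter_Icc, Set.nonempty_Icc, sup_le_iff, le_inf_iff, le_inf_iff] at h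
      simp only [hu, hv, dif_pos]
      exact ⟨trivial, trivial, fun h' => h.1 (Fin.ext h'), h.2.1.2, h.2.2.1⟩
    · rintro ⟨hu, hv, hne, h1, h2⟩
      simp only [hu, hv, dif_pos] at h1 h2
      refine ⟨hu, hv, ?_⟩
      rw [hadj, Set.Icc_inter_Icc, Set.nonempty_Icc, sup_le_iff, le_inf_iff, le_inf_iff]
      exact ⟨fun h => hne (Fin.mk.inj_iff.1 h), ⟨hlr _, h1⟩, h2, hlr _⟩

variable {n : ℕ} {m : ℕ → ℕ → ℕ}

open Classical in
/-- The numbers of successors in the orientation order the vertices like the right endpoints of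
the intervals. -/
theorem orient_count (ρ : ℕ → ℕ) (hm : IntervalMatrix n m) (h2 : ∀ i, m 2 i = 0)
    {m₁ m₂ : ℕ → ℕ → ℕ} (hm₁ : orientCmd.run n ρ m = m₁) (hm₂ : countCmd.run n ρ m₁ = m₂) :
    (∀ B, B ≠ 2 → B ≠ 3 → m₂ B = m B) ∧ ∀ u v w, m₂ 3 v ≤ m₂ 3 u → m₂ 3 w ≤ m₂ 3 v → v < n →
      v ≠ w → relOf n m 0 u w → relOf n m 0 v w := by
  obtain ⟨l, r, hlr, hadj⟩ := hm
  have hN : ∀ u v, nonadj n m u v ↔ u < n ∧ v < n ∧ (r u < l v ∨ r v < l u) := by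
    intro u v
    rw [nonadj, hadj]
    constructor
    · rintro ⟨hu, hv, hne, h⟩
      refine ⟨hu, hv, ?_⟩
      by_contra! h'
      exact h ⟨hu, hv, hne, h'.2, h'.1⟩
    · rintro ⟨hu, hv, h⟩
      refine ⟨hu, hv, ?_, fun h' => ?_⟩
      · rintro rfl
        rcases h with h | h <;> exact absurd (hlr u) (not_le.2 h)
      · rcases h with h | h
        · exact absurd h'.2.2.2.2 (not_le.2 h)
        · exact absurd h'.2.2.2.1 (not_le.2 h)
  have hs : ∀ u v, relOf n m 0 u v → relOf n m 0 v u := by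
    intro u v h
    rw [hadj] at h ⊢
    exact ⟨h.2.1, h.1, h.2.2.1.symm, h.2.2.2.2, h.2.2.2.1⟩
  have hsym := nonadj_symm hs
  have hinv := orientCmd_inv (n := n) (m := m) ρ hs h2 (F := fun u v => u < n ∧ v < n ∧ r u < l v)
    (fun u v h h' => by linarith [hlr u, hlr v, h.2.2, h'.2.2])
    (fun u v h => by
      obtain ⟨hu, hv, h | h⟩ := (hN u v).1 h
      · exact .inl ⟨hu, hv, h⟩
      · exact .inr ⟨hv, hu, h⟩)
    (by
      rintro ⟨a, b⟩ ⟨a', b'⟩ ⟨ha, hb, h⟩ ⟨-, h', ⟨h1, h3⟩ | ⟨h1, h3⟩⟩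
      · simp only at h1 h3 h' ha hb h ⊢
        subst h1
        rw [hN] at h'
        have h4 : ¬ (r b < l b' ∨ r b' < l b) := fun h => h3 ((hN _ _).2 ⟨hb, h'.2.1, h⟩)
        push Not at h4
        refine ⟨ha, h'.2.1, h'.2.2.resolve_right fun h5 => ?_⟩
        linarith [hlr a, h4.2]
      · simp only at h1 h3 h' ha hb h ⊢
        subst h1
        rw [hN] at h'
        have h4 : ¬ (r a < l a' ∨ r a' < l a) := fun h => h3 ((hN _ _).2 ⟨ha, h'.1, h⟩)
        push Not at h4
        refine ⟨h'.1, hb, h'.2.2.resolve_right fun h5 => ?_⟩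
        linarith [hlr b, h4.1])
  rw [hm₁] at hinv
  obtain ⟨f₂, c₂⟩ := countCmd_run (n := n) (m := m₁) (ρ := ρ)
  rw [hm₂] at f₂ c₂
  have htot : ∀ u v, nonadj n m u v → relOf n m₁ 2 u v ∨ relOf n m₁ 2 v u := fun u v h =>
    hinv.done u v (.inl h.1) h
  have hC4 : ∀ a b c d, nonadj n m a b → nonadj n m c d →
      nonadj n m a c ∨ nonadj n m a d ∨ nonadj n m b c ∨ nonadj n m b d := by
    intro a b c d hab hcd
    simp only [hN] at *
    obtain ⟨ha, hb, hab⟩ := hab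
    obtain ⟨hc, hd, hcd⟩ := hcd
    simp only [ha, hb, hc, hd, true_and]
    by_contra! h
    rcases hab with hab | hab <;> rcases hcd with hcd | hcd <;>
      linarith [h.1.1, h.1.2, h.2.1.1, h.2.1.2, h.2.2.1.1, h.2.2.1.2, h.2.2.2.1, h.2.2.2.2]
  have hsub : ∀ u v w, u < n → v < n → m₂ 3 v ≤ m₂ 3 u → relOf n m₁ 2 v w →
      relOf n m₁ 2 u w := by
    intro u v w hu hv hle hvw
    by_contra hn
    rw [c₂ u hu, c₂ v hv] at hle
    refine absurd hle (not_le.2 (Finset.card_lt_card (Finset.ssubset_iff_of_subset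
      (fun x hx => ?_) |>.2 ⟨w, ?_, ?_⟩)))
    · rw [Finset.mem_filter] at hx ⊢
      exact ⟨hx.1, (hinv.orientation.nested hsym htot hC4 hx.2 hvw).resolve_left hn⟩
    · rw [Finset.mem_filter, Finset.mem_range]
      exact ⟨hvw.2.1, hvw⟩
    · rw [Finset.mem_filter]
      exact fun h => hn h.2
  refine ⟨fun B hB hB' => (f₂ B hB').trans (hinv.frame B hB),
    fun u v w huv hvw hv hne huw => ?_⟩
  have hu := huw.1
  have hw := huw.2.1
  by_contra hn
  rcases htot v w ⟨hv, hw, hne, hn⟩ with h | h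
  · exact (hinv.orientation.rel _ _ (hsub u v w hu hv huv h)).2.2.2 huw
  · exact (hinv.orientation.rel _ _ (hsub v w v hv hw hvw h)).2.2.1 rfl

/-- What the coloring algorithm computes: `σ` lists the vertices in an order in which, for
`u < v < x`, a vertex at the position `x` that is adjacent to the one at `u` is adjacent to the
one at `v`, and the colors are obtained from the levels with respect to this order. -/
theorem coloringCmd_run (ρ : ℕ → ℕ) (hm : IntervalMatrix n m) (h2 : ∀ i, m 2 i = 0) :
    ∃ (pos σ : ℕ → ℕ) (K : ℕ → ℕ → Prop),
      (∀ v < n, pos v < n ∧ σ (pos v) = v) ∧ (∀ i < n, σ i < n ∧ pos (σ i) = i) ∧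
      (∀ u x, K u x ↔ u ≤ x ∧ (u = x ∨ x < n ∧ relOf n m 0 (σ u) (σ x))) ∧
      (∀ u v x, K u x → u ≤ v → v ≤ x → K v x) ∧
      ∀ i < n, coloringCmd.run n ρ m 1 (σ i) = 2 * level K i +
        ((Finset.range i).filter fun x => level K x = level K i).card % 2 := by
  obtain ⟨m₁, hm₁⟩ : ∃ m', orientCmd.run n ρ m = m' := ⟨_, rfl⟩
  obtain ⟨m₂, hm₂⟩ : ∃ m', countCmd.run n ρ m₁ = m' := ⟨_, rfl⟩
  obtain ⟨m₃, hm₃⟩ : ∃ m', sortCmd.run n ρ m₂ = m' := ⟨_, rfl⟩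
  obtain ⟨m₄, hm₄⟩ : ∃ m', greedyCmd.run n ρ m₃ = m' := ⟨_, rfl⟩
  obtain ⟨m₅, hm₅⟩ : ∃ m', levelCmd.run n ρ m₄ = m' := ⟨_, rfl⟩
  obtain ⟨m₆, hm₆⟩ : ∃ m', rankCmd.run n ρ m₅ = m' := ⟨_, rfl⟩
  have hrun : coloringCmd.run n ρ m = colorCmd.run n ρ m₆ := by
    rw [← hm₆, ← hm₅, ← hm₄, ← hm₃, ← hm₂, ← hm₁]
    rfl
  obtain ⟨f₂, hmono⟩ := orient_count ρ hm h2 hm₁ hm₂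
  obtain ⟨f₃, h₃⟩ := sortCmd_run (n := n) (m := m₂) (ρ := ρ)
  rw [hm₃] at f₃ h₃
  obtain ⟨f₄, h₄⟩ := greedyCmd_run (n := n) (m := m₃) (ρ := ρ)
  rw [hm₄] at f₄ h₄
  set pos := position (before m₂) n with hpos
  set σ := m₃ 4 with hσ
  set K := covers n m₃ with hK
  have hpos1 : ∀ v < n, pos v < n ∧ σ (pos v) = v := fun v hv =>
    ⟨position_lt before_irrefl hv, h₃ v hv⟩
  have hpos2 : ∀ i < n, σ i < n ∧ pos (σ i) = i := by
    intro i hi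
    obtain ⟨v, hv, rfl⟩ := exists_position_eq before_trans before_irrefl
      (before_total (m := m₂)) hi
    rw [h₃ v hv]
    exact ⟨hv, rfl⟩
  have h30 : m₃ 0 = m 0 := by rw [f₃ 0 (by omega), f₂ 0 (by omega) (by omega)]
  have hKiff : ∀ u x, K u x ↔ u ≤ x ∧ (u = x ∨ x < n ∧ relOf n m 0 (σ u) (σ x)) := by
    intro u x
    rw [hK, covers, h30]
    refine and_congr_right fun hux => or_congr_right (and_congr_right fun hx => ?_)
    exact ⟨fun h => ⟨(hpos2 u (by omega)).1, (hpos2 x hx).1, h⟩, fun h => h.2.2⟩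
  have hord : ∀ i j, i ≤ j → j < n → m₂ 3 (σ j) ≤ m₂ 3 (σ i) := by
    intro i j hij hj
    rcases hij.eq_or_lt with rfl | hij
    · exact le_rfl
    · have h1 := hpos2 i (by omega)
      have h2 := hpos2 j hj
      have := rel_of_position_lt before_trans before_irrefl (before_total (m := m₂))
        (u := σ i) (v := σ j) (n := n) h2.1 (by rw [← hpos, h1.2, h2.2]; exact hij)
      unfold before at this
      omega
  have hle : ∀ u x, K u x → u ≤ x := fun u x h => h.1
  have hC : ∀ u v x, K u x → u ≤ v → v ≤ x → K v x := by
    intro u v x hux huv hvx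
    rw [hKiff] at hux ⊢
    refine ⟨hvx, ?_⟩
    obtain ⟨-, rfl | ⟨hx, h⟩⟩ := hux
    · exact .inl (by omega)
    · rcases hvx.eq_or_lt with rfl | hvx
      · exact .inl rfl
      · refine .inr ⟨hx, hmono _ _ _ (hord u v huv (by omega)) (hord v x hvx.le hx)
          (hpos2 v (by omega)).1 (fun heq => ?_) h⟩
        have h1 := (hpos2 v (by omega)).2
        have h2 := (hpos2 x hx).2
        rw [heq, h2] at h1
        omega
  refine ⟨pos, σ, K, hpos1, hpos2, hKiff, hC, ?_⟩
  obtain ⟨f₅, h₅⟩ := levelCmd_run (n := n) (m := m₄) (ρ := ρ) hle hC h₄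
  rw [hm₅] at f₅ h₅
  obtain ⟨f₆, h₆⟩ := rankCmd_run (n := n) (m := m₅) (ρ := ρ)
  rw [hm₆] at f₆ h₆
  have h64 : m₆ 4 = σ := by
    rw [f₆ 4 (by omega), f₅ 4 (by omega), f₄ 4 (by omega)]
  have h67 : ∀ i < n, m₆ 7 i = ((Finset.range i).filter fun x => level K x = level K i).card := by
    intro i hi
    rw [h₆ i hi]
    congr 1
    refine Finset.filter_congr fun x hx => ?_
    rw [h₅ i hi, h₅ x ((Finset.mem_range.1 hx).trans hi)]
  intro i hi
  have h7 := colorCmd_run (n := n) (m := m₆) (ρ := ρ) (fun i j hi hj h => by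
    rw [h64] at h
    rw [← (hpos2 i hi).2, ← (hpos2 j hj).2, h]) (fun i hi => by
      rw [h67 i hi]
      exact (Finset.card_filter_le _ _).trans (Finset.card_range i).le) i hi
  rw [hrun, ← h64, h7, h67 i hi, f₆ 6 (by omega), h₅ i hi]

end RAM

/-- Positions of the same level and the same parity are not adjacent. -/
theorem not_covers_of_parity {K : ℕ → ℕ → Prop} (hle : ∀ u x, K u x → u ≤ x)
    (hC : ∀ u v x, K u x → u ≤ v → v ≤ x → K v x) (hrefl : ∀ x, K x x) {i j : ℕ} (hij : i < j)
    (hl : level K i = level K j)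
    (hp : ((Finset.range i).filter fun x => level K x = level K i).card % 2 =
      ((Finset.range j).filter fun x => level K x = level K j).card % 2) : ¬ K i j := by
  by_cases h : ∃ y, i < y ∧ y < j ∧ level K y = level K j
  · obtain ⟨y, hiy, hyj, hy⟩ := h
    exact not_adjacent_of_between hle hC hrefl hiy hyj hl hy
  · exfalso
    push Not at h
    have : (Finset.range j).filter (fun x => level K x = level K j) =
        insert i ((Finset.range i).filter fun x => level K x = level K i) := by
      ext x
      simp only [Finset.mem_filter, Finset.mem_range, Finset.mem_insert]
      constructor
      · rintro ⟨h1, h2⟩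
        by_cases hx : i < x
        · exact absurd h2 (h x hx h1)
        · rcases Nat.lt_or_ge x i with h3 | h3
          · exact .inr ⟨h3, h2.trans hl.symm⟩
          · exact .inl (by omega)
      · rintro (rfl | ⟨h1, h2⟩)
        · exact ⟨hij, hl⟩
        · exact ⟨h1.trans hij, h2.trans hl⟩
    rw [this, Finset.card_insert_of_notMem (by simp)] at hp
    omega

open Classical in
/-- The first `k` levels contain at least as many vertices as any `k` color classes. -/
theorem card_colors_le_card_level {n : ℕ} {G : SimpleGraph (Fin n)} {K : ℕ → ℕ → Prop}
    (hle : ∀ u x, K u x → u ≤ x) (hC : ∀ u v x, K u x → u ≤ v → v ≤ x → K v x)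
    {pos : Fin n → ℕ} (hinj : Function.Injective pos) (hlt : ∀ v, pos v < n)
    (hsurj : ∀ i < n, ∃ v, pos v = i)
    (hadj : ∀ v w, pos v < pos w → K (pos v) (pos w) → G.Adj v w)
    (ψ : G.Coloring ℕ+) (T : Finset ℕ+) :
    (Finset.univ.filter fun v => ψ v ∈ T).card ≤
      (Finset.univ.filter fun v => level K (pos v) ≤ T.card).card := by
  set S := (Finset.univ.filter fun v => ψ v ∈ T).image pos
  have hS : S ⊆ Finset.range n := fun i hi => by
    obtain ⟨v, -, rfl⟩ := Finset.mem_image.1 hi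
    exact Finset.mem_range.2 (hlt v)
  have hSk : ∀ u, (S.filter (K u)).card ≤ T.card := by
    intro u
    rw [Finset.filter_image, Finset.card_image_of_injective _ hinj]
    refine Finset.card_le_card_of_injOn ψ (fun v hv => ?_) fun v hv w hw heq => ?_
    · simp only [Finset.coe_filter, Finset.mem_filter, Finset.mem_univ, true_and,
        Set.mem_ofPred_eq] at hv
      exact hv.1
    · simp only [Finset.coe_filter, Finset.mem_filter, Finset.mem_univ, true_and,
        Set.mem_ofPred_eq] at hv hw
      rcases lt_trichotomy (pos v) (pos w) with h | h | h
      · exact absurd heq (ψ.valid (hadj v w h (hC _ _ _ hw.2 (hle _ _ hv.2) h.le)))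
      · exact hinj h
      · exact absurd heq.symm (ψ.valid (hadj w v h (hC _ _ _ hv.2 (hle _ _ hw.2) h.le)))
  calc (Finset.univ.filter fun v => ψ v ∈ T).card = S.card :=
        (Finset.card_image_of_injective _ hinj).symm
    _ ≤ (chosen K T.card n).card := card_le_card_chosen hle hC n hS hSk
    _ ≤ ((Finset.univ.filter fun v => level K (pos v) ≤ T.card).image pos).card := by
        refine Finset.card_le_card fun i hi => ?_
        obtain ⟨hin, hl⟩ := (mem_chosen_iff_level hle hC).1 hi
        obtain ⟨v, rfl⟩ := hsurj i hin
        exact Finset.mem_image_of_mem _ (by simpa using hl)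
    _ ≤ _ := Finset.card_image_le

theorem theorem9 :
    MinEntropyColoringApproxInPolyTime (fun _ G => IsIntervalGraph G) 1 := by
  refine ⟨RAM.coloringCmd.prog 0, RAM.coloringCmd.cost, fun n G hG => ?_⟩
  obtain ⟨t, s, hexec, ht, harr, -⟩ := RAM.coloringCmd.exec_prog (n := n) 0 (fun _ => 0)
    (RAM.graphInput G).arr (RAM.graphInput G) ⟨by simp [RAM.graphInput],
      fun x => by simp [RAM.graphInput], rfl⟩
  obtain ⟨pos, σ, K, hpos, hσ, hK, hC, hcol⟩ := RAM.coloringCmd_run (n := n) (fun _ => 0)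
    (RAM.intervalMatrix_graphInput hG) (fun i => by simp [RAM.graphInput])
  have hle : ∀ u x, K u x → u ≤ x := fun u x h => ((hK u x).1 h).1
  have hrefl : ∀ x, K x x := fun x => (hK x x).2 ⟨le_rfl, .inl rfl⟩
  have hadj : ∀ v w : Fin n, pos v < pos w → (K (pos v) (pos w) ↔ G.Adj v w) := by
    intro v w hvw
    rw [hK, (hpos v v.2).2, (hpos w w.2).2, RAM.relOf_graphInput]
    constructor
    · rintro ⟨-, h | ⟨-, _, _, h⟩⟩
      · omega
      · exact h
    · exact fun h => ⟨hvw.le, .inr ⟨(hpos w w.2).1, v.2, w.2, h⟩⟩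
  have hinj : Function.Injective fun v : Fin n => pos v := fun v w h => by
    refine Fin.ext ?_
    rw [← (hpos v v.2).2, ← (hpos w w.2).2]
    exact congrArg σ h
  set c : ℕ → ℕ := fun i => 2 * level K i +
    ((Finset.range i).filter fun x => level K x = level K i).card % 2 with hc
  have hproper : ∀ i j, i < j → c i = c j → ¬ K i j := by
    intro i j hij h
    simp only [hc] at h
    exact not_covers_of_parity hle hC hrefl hij (by omega) (by omega)
  have hcpos : ∀ i, 0 < c i := fun i => by
    have := level_pos hrefl i
    simp only [hc]
    omega
  refine ⟨t, s, SimpleGraph.Coloring.mk (fun v => ⟨c (pos v), hcpos _⟩) ?_, hexec, ht,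
    fun v => ?_, fun ψ => ?_⟩
  · intro v w hvw heq
    have h : c (pos v) = c (pos w) := congrArg PNat.val heq
    rcases lt_trichotomy (pos v) (pos w) with h' | h' | h'
    · exact hproper _ _ h' h ((hadj v w h').2 hvw)
    · exact hvw.ne (hinj h')
    · exact hproper _ _ h' h.symm ((hadj w v h').2 hvw.symm)
  · rw [harr]
    have h := hcol (pos v) (hpos v v.2).1
    rw [(hpos v v.2).2] at h
    exact h
  · refine coloringEntropy_le_add_one _ ψ (fun v => level K (pos v))
      (fun v => level_pos hrefl _) (fun v => ?_) fun T => ?_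
    · change c (pos v) / 2 = _
      simp only [hc]
      omega
    · have := card_colors_le_card_level hle hC hinj (fun v => (hpos v v.2).1)
        (fun i hi => ⟨⟨σ i, (hσ i hi).1⟩, (hσ i hi).2⟩) (fun v w h => (hadj v w h).1) ψ T
      convert this
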